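/- Let $d\ge 1$. For $h>0$ write $f_j=f(hj)$, $j\in\mathbb Z^d$, for functions $f$ on $(h\mathbb Z)^d$, and let $$\Delta_{\mathrm d} f_j=\frac1{h^2}\sum_{k=1}^d\big(f_{j+e_k}-2f_j+f_{j-e_k}\big).$$ Let $K_\nu$ be Macdonald's function (the modified Bessel function of the second kind), $K_\nu(z)=\int_0^\infty e^{-z\cosh s}\cosh(\nu s)\,ds$ for $\nu\in\mathbb R$, $z>0$. For real-valued $V_j(t)$ and $u_j(t)$ put $$\|V\|_\infty=\sup_{j\in\mathbb Z^d,\,t\in[0,1]}|V_j(t)|,\qquad \|u\|_2=\Big(h^d\int_0^1\sum_{j\in\mathbb Z^d}|u_j(t)|^2\,dt\Big)^{1/2}.$$ We say that $u$ solves $(\mathrm P_{h,V})$ if $u\in C^1([0,1];\ell^2((h\mathbb Z)^d))$ and $\partial_t u_j=\Delta_{\mathrm d}u_j+V_ju_j$ for all $j\in\mathbb Z^d$ and $t\in(0,1)$. (1) There is a constant $C=C(d)>0$ such that for every $\gamma\in(0,C)$ and all finite constants $A,B,c\ge 0$ there is $h_0>0$ with the following property. If $h\in(0,h_0)$, $u$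 solves $(\mathrm P_{h,V})$, $\|V\|_\infty\le A$, $\|u\|_2\le B$ and $$h^d\sum_{j\in\mathbb Z^d}\ \prod_{k=1}^d\frac{K_{j_k}^2(\gamma/h^2)}{K_0^2(\gamma/h^2)}\ \big(|u_j(0)|^2+|u_j(1)|^2\big)\le c,$$ then $u\equiv0$ on $[0,1]$. (2) There is a constant $\mu_0=\mu_0(d)>0$ such that for every $\mu>\mu_0$ and every $h>0$: if $u$ solves $(\mathrm P_{h,V})$ with $\|V\|_\infty<\infty$, $\|u\|_2<\infty$ and $$h^d\sum_{j\in\mathbb Z^d}\ \prod_{k=1}^d\frac{K_{\mu j_k}\big(\tfrac{2}{eh^2}\big)}{K_0\big(\tfrac{2}{eh^2}\big)}\ \big(|u_j(0)|^2+|u_j(1)|^2\big)<\infty,$$ then $u\equiv0$ on $[0,1]$. -/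

import Mathlib

open scoped ENNReal NNReal

noncomputable section

/-- Macdonald's function (modified Bessel function of the second kind) of real order `ν`,
`K_ν(z) = ∫₀^∞ exp (-z cosh s) cosh (ν s) ds`, for real argument `z > 0`. -/
def macdonaldK (ν z : ℝ) : ℝ :=
  ∫ s in Set.Ioi (0 : ℝ), Real.exp (-z * Real.cosh s) * Real.cosh (ν * s)

/-- Real square summable sequences on `ℤ^d`. A function `f` on the mesh `(hℤ)^d` is encoded by
`f_j = f (h j)`; the norm of `ℓ²((hℤ)^d)` is `h ^ (d / 2)` times the norm of this space. -/
abbrev LatticeL2 (d : ℕ) : Type := lp (fun _ : Fin d → ℤ => ℝ) 2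

/-- The discrete Laplacian on `(hℤ)^d`. -/
def discreteLaplacian {d : ℕ} (h : ℝ) (f : (Fin d → ℤ) → ℝ) (j : Fin d → ℤ) : ℝ :=
  1 / h ^ 2 * ∑ k : Fin d, (f (j + Pi.single k 1) - 2 * f j + f (j - Pi.single k 1))

/-- `u ∈ C¹([0,1] : ℓ²((hℤ)^d))` solves `∂ₜ u_j = Δ u_j + V_j u_j`. -/
structure IsHeatSolution {d : ℕ} (h : ℝ) (V : (Fin d → ℤ) → ℝ → ℝ)
    (u : ℝ → LatticeL2 d) : Prop where
  contDiffOn : ContDiffOn ℝ 1 u (Set.Icc 0 1)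
  equation : ∀ t ∈ Set.Ioo (0 : ℝ) 1, ∀ j : Fin d → ℤ,
    HasDerivAt (fun s => u s j) (discreteLaplacian h (u t) j + V j t * u t j) t

/-- `‖V‖_∞`, the supremum of `|V_j(t)|` over `j ∈ ℤ^d` and `t ∈ [0,1]`. -/
def potentialNorm {d : ℕ} (V : (Fin d → ℤ) → ℝ → ℝ) : ℝ≥0∞ :=
  ⨆ j : Fin d → ℤ, ⨆ t ∈ Set.Icc (0 : ℝ) 1, ENNReal.ofReal |V j t|

/-- `‖u‖₂ = (h^d ∫₀¹ ∑_j |u_j(t)|² dt)^{1/2}`. -/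
def spaceTimeNorm {d : ℕ} (h : ℝ) (u : ℝ → LatticeL2 d) : ℝ≥0∞ :=
  (ENNReal.ofReal (h ^ d) *
    ∫⁻ t in Set.Icc (0 : ℝ) 1, ∑' j : Fin d → ℤ, ENNReal.ofReal (|u t j| ^ 2)) ^ (1 / 2 : ℝ)

/-- `h^d ∑_j w_j (|u_j(0)|² + |u_j(1)|²)` for a weight `w ≥ 0`. -/
def twoTimeEnergy {d : ℕ} (h : ℝ) (w : (Fin d → ℤ) → ℝ) (u : ℝ → LatticeL2 d) : ℝ≥0∞ :=
  ENNReal.ofReal (h ^ d) *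
    ∑' j : Fin d → ℤ, ENNReal.ofReal (w j * (|u 0 j| ^ 2 + |u 1 j| ^ 2))

/-- The weight `∏_k K_{j_k}²(γ/h²) / K_0²(γ/h²)`. -/
def continuumWeight {d : ℕ} (γ h : ℝ) (j : Fin d → ℤ) : ℝ :=
  ∏ k : Fin d, macdonaldK (j k) (γ / h ^ 2) ^ 2 / macdonaldK 0 (γ / h ^ 2) ^ 2

/-- The weight `∏_k K_{μ j_k}(2/(e h²)) / K_0(2/(e h²))`. -/
def discreteWeight {d : ℕ} (μ h : ℝ) (j : Fin d → ℤ) : ℝ :=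
  ∏ k : Fin d, macdonaldK ((j k : ℝ) * μ) (2 / (Real.exp 1 * h ^ 2)) /
    macdonaldK 0 (2 / (Real.exp 1 * h ^ 2))

end

/-
The slices of `u` along one coordinate axis form a ladder: the time derivative of each slice is
driven by its two neighbours, up to a bounded perturbation. The asymptotics of Macdonald's function
in its order turn either weighted energy into the bound `1 / (n! 256 ^ n)`, up to a constant, for
the `n`-th (rescaled) slice at times `0` and `1`, and comparison with a linear system of
differential inequalities propagates decay of the form `r ^ n / n!` to all intermediate times.

This decay admits a Carleman inequality with the weight `(n + m)! ρ(t) ^ (n + m)`, where `ρ` is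
bell-shaped with its maximum at `t = 1 / 2`: it comes from the positivity of a commutator of Jacobi
(three-term) operators. At the end points the weighted solution is exponentially smaller in `m` than
at `t = 1 / 2`, so `m → ∞` forces the first rung to vanish at `t = 1 / 2`. The ladder can be started
at any slice, so `u` vanishes at `t = 1 / 2`, and hence at all times because the discrete Laplacian
is bounded.
-/

section Calculus

theorem norm_le_of_norm_deriv_le_Icc {E : Type*} [NormedAddCommGroup E] [NormedSpace ℝ E]
    {f f' : ℝ → E} {B B' : ℝ → ℝ} {a b : ℝ} (hf : ContinuousOn f (Set.Icc a b))
    (hf' : ∀ t ∈ Set.Ioo a b, HasDerivAt f (f' t) t) (hB : ContinuousOn B (Set.Icc a b))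
    (hB' : ∀ t ∈ Set.Ioo a b, HasDerivAt B (B' t) t)
    (hle : ∀ t ∈ Set.Ioo a b, ‖f' t‖ ≤ B' t) (ha : ‖f a‖ ≤ B a) {t : ℝ}
    (ht : t ∈ Set.Icc a b) : ‖f t‖ ≤ B t := by
  obtain ⟨g, hg, hgt⟩ := exists_dual_vector'' ℝ (f t)
  have hgle (x : E) : g x ≤ ‖x‖ := by
    simpa using (le_abs_self _).trans (g.le_of_opNorm_le hg x)
  have hmono : MonotoneOn (fun s => B s - g (f s)) (Set.Icc a b) := by
    refine monotoneOn_of_hasDerivWithinAt_nonneg (convex_Icc a b)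
      (hB.sub (g.continuous.comp_continuousOn hf)) (f' := fun s => B' s - g (f' s)) ?_ ?_
    · intro s hs
      rw [interior_Icc] at hs
      exact ((hB' s hs).sub (g.hasFDerivAt.comp_hasDerivAt s (hf' s hs))).hasDerivWithinAt
    · intro s hs
      rw [interior_Icc] at hs
      exact sub_nonneg.2 ((hgle _).trans (hle s hs))
  have hcompare := hmono (Set.left_mem_Icc.2 (ht.1.trans ht.2)) ht ht.1
  have : g (f t) = ‖f t‖ := by simpa using hgt
  linarith [hgle (f a)]

theorem norm_le_exp_of_norm_deriv_le {ι E : Type*} [NormedAddCommGroup E] [NormedSpace ℝ E]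
    {f f' : ι → ℝ → E} {K B D : ℝ} (hK : 0 ≤ K) (hD : 0 ≤ D) (hB₀ : 0 ≤ B)
    (hf : ∀ i, ContinuousOn (f i) (Set.Icc 0 1))
    (hf' : ∀ i, ∀ t ∈ Set.Ioo (0 : ℝ) 1, HasDerivAt (f i) (f' i t) t)
    (hB : ∀ i, ∀ t ∈ Set.Icc (0 : ℝ) 1, ‖f i t‖ ≤ B)
    (h0 : ∀ i, ‖f i 0‖ ≤ D)
    (hle : ∀ t ∈ Set.Ioo (0 : ℝ) 1, ∀ s, D ≤ s → (∀ j, ‖f j t‖ ≤ s) → ∀ i, ‖f' i t‖ ≤ K * s)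
    (i : ι) {t : ℝ} (ht : t ∈ Set.Icc (0 : ℝ) 1) : ‖f i t‖ ≤ D * Real.exp (K * t) := by
  have iterate (k : ℕ) : ∀ i, ∀ t ∈ Set.Icc (0 : ℝ) 1,
      ‖f i t‖ ≤ D * Real.exp (K * t) + B * ((K * t) ^ k / k.factorial) := by
    induction k with
    | zero =>
      intro i t ht
      have := hB i t ht
      simp only [pow_zero, Nat.factorial_zero, Nat.cast_one, div_one, mul_one]
      linarith [mul_nonneg hD (Real.exp_nonneg (K * t))]
    | succ k ih =>
      intro i t ht
      refine norm_le_of_norm_deriv_le_Icc (f' := f' i)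
        (B' := fun t => K * (D * Real.exp (K * t) + B * ((K * t) ^ k / k.factorial)))
        (B := fun t => D * Real.exp (K * t) + B * ((K * t) ^ (k + 1) / (k + 1).factorial))
        (hf i) (hf' i) (by fun_prop) (fun s _ => ?_) (fun s hs => ?_) (by simpa using h0 i) ht
      · have hlin : HasDerivAt (fun s : ℝ => K * s) K s := by
          simpa using (hasDerivAt_id s).const_mul K
        refine ((hlin.exp.const_mul D).add
          (((hlin.pow (k + 1)).div_const _).const_mul B)).congr_deriv ?_
        rw [Nat.factorial_succ]
        push_cast
        field_simp
      · have hs' := Set.Ioo_subset_Icc_self hs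
        refine hle s hs _ ?_ (fun j => ih j s hs') i
        have hexp : 1 ≤ Real.exp (K * s) := Real.one_le_exp (mul_nonneg hK hs'.1)
        have hterm : 0 ≤ (K * s) ^ k / k.factorial := by have := mul_nonneg hK hs'.1; positivity
        nlinarith [mul_nonneg hB₀ hterm]
  refine ge_of_tendsto' (x := Filter.atTop) ?_ fun k => iterate k i t ht
  simpa using ((FloorSemiring.tendsto_pow_div_factorial_atTop (K * t)).const_mul B).const_add
    (D * Real.exp (K * t))

theorem eq_zero_of_norm_deriv_le_mul_norm {H : Type*} [NormedAddCommGroup H]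
    [InnerProductSpace ℝ H] {f f' : ℝ → H} {K a b t₀ : ℝ}
    (hf : ContinuousOn f (Set.Icc a b)) (hf' : ∀ t ∈ Set.Ioo a b, HasDerivAt f (f' t) t)
    (hle : ∀ t ∈ Set.Ioo a b, ‖f' t‖ ≤ K * ‖f t‖) (ht₀ : t₀ ∈ Set.Ioo a b) (h₀ : f t₀ = 0) :
    ∀ t ∈ Set.Icc a b, f t = 0 := by
  -- `f` solves the linear equation `x' = A t x`, whose rank-one coefficient is bounded by `K`.
  let A (t : ℝ) (x : H) : H := (inner ℝ (f t) x / ‖f t‖ ^ 2) • f' t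
  have hAf (t : ℝ) (ht : t ∈ Set.Ioo a b) : A t (f t) = f' t := by
    by_cases h : f t = 0
    · have : f' t = 0 := norm_le_zero_iff.1 (by simpa [h] using hle t ht)
      simp [A, this]
    · simp [A, h]
  have hlip (t : ℝ) (ht : t ∈ Set.Ioo a b) :
      LipschitzOnWith K.toNNReal (A t) Set.univ := by
    refine (LipschitzWith.of_dist_le_mul fun x y => ?_).lipschitzOnWith
    have hsub : A t x - A t y = (inner ℝ (f t) (x - y) / ‖f t‖ ^ 2) • f' t := by
      rw [← sub_smul, ← sub_div, ← inner_sub_right]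
    rw [dist_eq_norm, dist_eq_norm, hsub, norm_smul, norm_div, norm_pow, norm_norm]
    rcases eq_or_ne (f t) 0 with h | h
    · have : 0 ≤ K.toNNReal * ‖x - y‖ := by positivity
      simpa [h] using this
    have := norm_pos_iff.2 h
    calc ‖inner ℝ (f t) (x - y)‖ / ‖f t‖ ^ 2 * ‖f' t‖
        ≤ ‖f t‖ * ‖x - y‖ / ‖f t‖ ^ 2 * (K * ‖f t‖) := by
          gcongr
          · exact norm_inner_le_norm _ _
          · exact hle t ht
      _ = K * ‖x - y‖ := by field_simp
      _ ≤ K.toNNReal * ‖x - y‖ := by gcongr; exact Real.le_coe_toNNReal K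
  exact ODE_solution_unique_of_mem_Icc (v := A) (s := fun _ => Set.univ) (g := fun _ => 0) hlip
    ht₀ hf (fun t ht => (hAf t ht).symm ▸ hf' t ht) (fun _ _ => Set.mem_univ _) continuousOn_const
    (fun t _ => by simpa [A] using hasDerivAt_const t (0 : H)) (fun _ _ => Set.mem_univ _) h₀

end Calculus

section Ladder

variable {H : Type*} [NormedAddCommGroup H] [InnerProductSpace ℝ H] {A τ T : ℝ}
  {v v' : ℕ → ℝ → H}

/-- A chain of curves with `∂ₜ v_{n+1} = v_n + τ v_{n+2} + O(A |v_{n+1}|)` on `(0, 1)`, the shape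
taken by the heat equation on consecutive slices of the lattice; `v n` is the `n`-th rung. -/
structure IsLadder (A τ : ℝ) (v v' : ℕ → ℝ → H) : Prop where
  continuousOn : ∀ n, ContinuousOn (v n) (Set.Icc 0 1)
  hasDerivAt : ∀ n, ∀ t ∈ Set.Ioo (0 : ℝ) 1, HasDerivAt (v n) (v' n t) t
  residual_le : ∀ n, ∀ t ∈ Set.Ioo (0 : ℝ) 1,
    ‖v' (n + 1) t - v n t - τ • v (n + 2) t‖ ≤ A * ‖v (n + 1) t‖

theorem IsLadder.norm_deriv_le (hv : IsLadder A τ v v') (hτ : 0 ≤ τ) (n : ℕ) {t : ℝ}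
    (ht : t ∈ Set.Ioo (0 : ℝ) 1) :
    ‖v' (n + 1) t‖ ≤ ‖v n t‖ + τ * ‖v (n + 2) t‖ + A * ‖v (n + 1) t‖ := by
  calc ‖v' (n + 1) t‖
      = ‖v n t + τ • v (n + 2) t + (v' (n + 1) t - v n t - τ • v (n + 2) t)‖ := by
        congr 1; abel
    _ ≤ ‖v n t‖ + ‖τ • v (n + 2) t‖ + A * ‖v (n + 1) t‖ :=
        norm_add₃_le.trans (by gcongr; exact hv.residual_le n t ht)
    _ = _ := by rw [norm_smul, Real.norm_of_nonneg hτ]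

theorem exists_capped_pow {L : ℝ} (hT : 0 < T) (hTL : T ≤ L) (N : ℕ) :
    ∃ c : ℕ → ℝ, (∀ k, 0 < c k) ∧ (∀ k, c k ≤ L ^ k) ∧ (∀ k, c k ≤ (L / T) ^ N * T ^ k) ∧
      c N = L ^ N ∧ (∀ k, c (k + 1) ≤ L * c k) ∧ ∀ k, T * c k ≤ c (k + 1) := by
  have hL : 0 < L := hT.trans_le hTL
  have : 0 < (L / T) ^ N := by positivity
  refine ⟨fun k => min (L ^ k) ((L / T) ^ N * T ^ k), fun k => by positivity,
    fun k => min_le_left _ _, fun k => min_le_right _ _,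
    min_eq_left (by rw [← mul_pow, div_mul_cancel₀ L hT.ne']), fun k => ?_, fun k => ?_⟩
  · simp only [mul_min_of_nonneg _ _ hL.le, pow_succ', mul_left_comm L]
    gcongr
  · simp only [mul_min_of_nonneg _ _ hT.le, pow_succ', mul_left_comm T]
    gcongr

theorem mul_le_of_le_three_term {c x : ℕ → ℝ} {L b y : ℝ} {k : ℕ} (hA : 0 ≤ A) (hτ : 0 ≤ τ)
    (hT : 0 < T) (hL : 0 ≤ L) (hx : ∀ n, 0 ≤ x n) (hc : 0 ≤ c (k + 1))
    (hc_succ_le : c (k + 1) ≤ L * c k) (hc_le_succ : T * c (k + 1) ≤ c (k + 2))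
    (hb : ∀ n, c n * x n ≤ b) (hy : y ≤ x k + τ * x (k + 2) + A * x (k + 1)) :
    c (k + 1) * y ≤ (L + τ / T + A) * b := by
  have := hx k
  have := hx (k + 2)
  calc c (k + 1) * y
      ≤ c (k + 1) * (x k + τ * x (k + 2) + A * x (k + 1)) := by gcongr
    _ = c (k + 1) * x k + τ / T * (T * c (k + 1) * x (k + 2)) + A * (c (k + 1) * x (k + 1)) := by
        field_simp
    _ ≤ L * c k * x k + τ / T * (c (k + 2) * x (k + 2)) + A * (c (k + 1) * x (k + 1)) := by gcongr
    _ ≤ (L + τ / T + A) * b := by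
        rw [mul_assoc, add_mul, add_mul]
        gcongr
        exacts [hb k, hb _, hb _]

theorem pow_mul_norm_le_exp_of_norm_deriv_le {E : Type*} [NormedAddCommGroup E]
    [NormedSpace ℝ E] {v v' : ℕ → ℝ → E} {M L D : ℝ} (hA : 0 ≤ A) (hτ : 0 ≤ τ) (hT : 0 < T)
    (hTL : T ≤ L) (hcont : ∀ n, ContinuousOn (v n) (Set.Icc 0 1))
    (hderiv : ∀ n, ∀ t ∈ Set.Ioo (0 : ℝ) 1, HasDerivAt (v n) (v' n t) t)
    (hle : ∀ n, ∀ t ∈ Set.Ioo (0 : ℝ) 1,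
      ‖v' (n + 1) t‖ ≤ ‖v n t‖ + τ * ‖v (n + 2) t‖ + A * ‖v (n + 1) t‖)
    (hM : ∀ n, ∀ t ∈ Set.Icc (0 : ℝ) 1, T ^ n * ‖v n t‖ ≤ M)
    (hMD : M ≤ D) (h0 : ∀ n, L ^ n * ‖v n 0‖ ≤ D) (n : ℕ) {t : ℝ}
    (ht : t ∈ Set.Icc (0 : ℝ) 1) :
    L ^ n * ‖v n t‖ ≤ D * Real.exp ((L + τ / T + A) * t) := by
  have hL : 0 < L := hT.trans_le hTL
  have hM₀ : 0 ≤ M := le_trans (by positivity) (hM 0 t ht)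
  have hD : 0 ≤ D := hM₀.trans hMD
  have hK : 0 ≤ L + τ / T + A := by positivity
  obtain _ | N := n
  · have hexp := Real.one_le_exp (mul_nonneg hK ht.1)
    nlinarith [hM 0 t ht]
  obtain ⟨c, hc, hc_le_pow, hc_le_cap, hcN, hc_succ_le, hc_le_succ⟩ :=
    exists_capped_pow hT hTL (N + 1)
  have hnorm (k : ℕ) (x : E) : ‖c k • x‖ = c k * ‖x‖ := by
    rw [norm_smul, Real.norm_of_nonneg (hc k).le]
  have key := norm_le_exp_of_norm_deriv_le (f := fun k t => c (k + 1) • v (k + 1) t)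
    (f' := fun k t => c (k + 1) • v' (k + 1) t) (B := (L / T) ^ (N + 1) * M) hK hD (by positivity)
    (fun k => (hcont _).fun_const_smul _) (fun k s hs => (hderiv _ s hs).fun_const_smul _)
    (fun k s hs => ?_) (fun k => ?_) (fun s hs b hDb hb k => ?_) N ht
  · rwa [hnorm, hcN] at key
  · rw [hnorm]
    calc c (k + 1) * ‖v (k + 1) s‖
        ≤ (L / T) ^ (N + 1) * T ^ (k + 1) * ‖v (k + 1) s‖ := by gcongr; exact hc_le_cap _
      _ ≤ (L / T) ^ (N + 1) * M := by rw [mul_assoc]; gcongr; exact hM _ s hs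
  · rw [hnorm]
    exact (mul_le_mul_of_nonneg_right (hc_le_pow _) (norm_nonneg _)).trans (h0 (k + 1))
  · have hb' (k : ℕ) : c k * ‖v k s‖ ≤ b := by
      obtain _ | k := k
      · have hc0 : c 0 ≤ 1 := (hc_le_pow 0).trans_eq (pow_zero L)
        have hv0 := hM 0 s (Set.Ioo_subset_Icc_self hs)
        nlinarith [norm_nonneg (v 0 s)]
      · rw [← hnorm]; exact hb k
    rw [hnorm]
    exact mul_le_of_le_three_term (c := c) (x := fun k => ‖v k s‖) hA hτ hT hL.le
      (fun _ => norm_nonneg _) (hc (k + 1)).le (hc_succ_le k) (hc_le_succ (k + 1)) hb' (hle k s hs)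

theorem IsLadder.pow_mul_norm_le_exp {M L D : ℝ} (hv : IsLadder A τ v v') (hA : 0 ≤ A)
    (hτ : 0 ≤ τ) (hT : 0 < T) (hTL : T ≤ L)
    (hM : ∀ n, ∀ t ∈ Set.Icc (0 : ℝ) 1, T ^ n * ‖v n t‖ ≤ M) (hMD : M ≤ D)
    (h0 : ∀ n, L ^ n * ‖v n 0‖ ≤ D) (h1 : ∀ n, L ^ n * ‖v n 1‖ ≤ D) (n : ℕ) {t : ℝ}
    (ht : t ∈ Set.Icc (0 : ℝ) 1) :
    L ^ n * ‖v n t‖ ≤ D * Real.exp ((L + τ / T + A) / 2) := by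
  have hK : 0 ≤ L + τ / T + A := by have := hT.trans_le hTL; positivity
  have hD : 0 ≤ D := (by positivity : 0 ≤ T ^ 0 * ‖v 0 t‖).trans ((hM 0 t ht).trans hMD)
  rcases le_total t (1 / 2) with h | h
  · refine (pow_mul_norm_le_exp_of_norm_deriv_le hA hτ hT hTL hv.continuousOn hv.hasDerivAt
      (fun n s hs => hv.norm_deriv_le hτ n hs) hM hMD h0 n ht).trans ?_
    gcongr
    nlinarith
  · have hmaps : Set.MapsTo (fun s : ℝ => 1 - s) (Set.Icc 0 1) (Set.Icc 0 1) :=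
      fun s hs => ⟨by linarith [hs.2], by linarith [hs.1]⟩
    have hmaps' : Set.MapsTo (fun s : ℝ => 1 - s) (Set.Ioo 0 1) (Set.Ioo 0 1) :=
      fun s hs => ⟨by linarith [hs.2], by linarith [hs.1]⟩
    have key := pow_mul_norm_le_exp_of_norm_deriv_le (v := fun n s => v n (1 - s))
      (v' := fun n s => -v' n (1 - s)) hA hτ hT hTL
      (fun n => (hv.continuousOn n).comp (by fun_prop) hmaps)
      (fun n s hs => (hv.hasDerivAt n (1 - s) (hmaps' hs)).comp_const_sub 1 s)
      (fun n s hs => by rw [norm_neg]; exact hv.norm_deriv_le hτ n (hmaps' hs))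
      (fun n s hs => hM n (1 - s) (hmaps hs)) hMD (by simpa using h1) n (hmaps ht)
    rw [sub_sub_cancel] at key
    refine key.trans ?_
    gcongr
    nlinarith

theorem pow_mul_le_mul_exp_of_factorial_decay {a : ℕ → ℝ} {X C L : ℝ} (hX : 0 < X) (hL : 0 ≤ L)
    (hC : 0 ≤ C) (ha : ∀ n, n.factorial * X ^ n * a n ≤ C) (n : ℕ) :
    L ^ n * a n ≤ C * Real.exp (L / X) := by
  calc L ^ n * a n = (n.factorial * X ^ n * a n) * ((L / X) ^ n / n.factorial) := by
        rw [div_pow]; field_simp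
    _ ≤ C * Real.exp (L / X) := by
        gcongr
        · exact ha n
        · exact Real.pow_div_factorial_le_exp _ (by positivity) n

theorem IsLadder.exists_factorial_decay {X C M : ℝ} (hv : IsLadder A τ v v') (hA : 0 ≤ A)
    (hτ : 0 ≤ τ) (hT : 0 < T) (hX : 0 < X)
    (hM : ∀ n, ∀ t ∈ Set.Icc (0 : ℝ) 1, T ^ n * ‖v n t‖ ≤ M)
    (h0 : ∀ n : ℕ, n.factorial * X ^ n * ‖v n 0‖ ≤ C)
    (h1 : ∀ n : ℕ, n.factorial * X ^ n * ‖v n 1‖ ≤ C) :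
    ∃ C₁, ∀ n : ℕ, ∀ t ∈ Set.Icc (0 : ℝ) 1,
      n.factorial * ‖v n t‖ ≤ C₁ * (Real.exp 1 * (1 / 2 + 1 / X)) ^ n := by
  have hM₀ : 0 ≤ M := (norm_nonneg (v 0 0)).trans (by simpa using hM 0 0 (by simp))
  have hC : 0 ≤ C := (norm_nonneg (v 0 0)).trans (by simpa using h0 0)
  set s := 1 / 2 + 1 / X with hs
  have hs₀ : 0 < s := by positivity
  refine ⟨(M + C) * Real.exp (T * s + (τ / T + A) / 2), fun n t ht => ?_⟩
  -- Choose the base `L` close to `n / s`, which minimizes `exp (L * s) / L ^ n`.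
  let L := T + n / s
  have hL : 0 < L := by positivity
  have hend {a : ℕ → ℝ} (ha : ∀ k, k.factorial * X ^ k * a k ≤ C) (k : ℕ) :
      L ^ k * a k ≤ (M + C) * Real.exp (L / X) := by
    refine (pow_mul_le_mul_exp_of_factorial_decay hX hL.le hC ha k).trans ?_
    gcongr
    linarith
  have hMD : M ≤ (M + C) * Real.exp (L / X) := by
    nlinarith [Real.one_le_exp (x := L / X) (by positivity)]
  have hfac : (n.factorial : ℝ) ≤ s ^ n * L ^ n := by
    rw [← mul_pow]
    calc (n.factorial : ℝ) ≤ (n : ℝ) ^ n := by exact_mod_cast n.factorial_le_pow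
      _ ≤ (s * L) ^ n := by
        gcongr
        simp only [L, mul_add, mul_div_cancel₀ _ hs₀.ne']
        linarith [mul_pos hs₀ hT]
  calc n.factorial * ‖v n t‖ ≤ s ^ n * (L ^ n * ‖v n t‖) := by
        rw [← mul_assoc]; gcongr
    _ ≤ s ^ n * ((M + C) * Real.exp (L / X) * Real.exp ((L + τ / T + A) / 2)) := by
        refine mul_le_mul_of_nonneg_left ?_ (by positivity)
        exact hv.pow_mul_norm_le_exp hA hτ hT (le_add_of_nonneg_right (by positivity)) hM hMD
          (hend h0) (hend h1) n ht
    _ = (M + C) * Real.exp (T * s + (τ / T + A) / 2) * (Real.exp 1 * s) ^ n := by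
        have hexp : L / X + (L + τ / T + A) / 2 = T * s + (τ / T + A) / 2 + n * 1 := by
          have : L * s = T * s + n := by simp only [L]; field_simp
          rw [hs] at this ⊢
          linear_combination this
        rw [mul_assoc (M + C), ← Real.exp_add, hexp, Real.exp_add, Real.exp_nat_mul, mul_pow]
        ring

end Ladder

section Carleman

variable {H : Type*} [NormedAddCommGroup H] [InnerProductSpace ℝ H]

/-- The symmetric part of the operator `x ↦ p_{n+1} x_{n+1} + b_n x_n` on sequences. -/
noncomputable def symmPart (p b : ℕ → ℝ) (x : ℕ → H) (n : ℕ) : H :=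
  p (n + 1) • x (n + 1) + (1 / 2 : ℝ) • (b n • x n + b (n + 1) • x (n + 2))

/-- The antisymmetric part of the operator `x ↦ p_{n+1} x_{n+1} + b_n x_n` on sequences. -/
noncomputable def skewPart (b : ℕ → ℝ) (x : ℕ → H) (n : ℕ) : H :=
  (1 / 2 : ℝ) • (b n • x n - b (n + 1) • x (n + 2))

theorem symmPart_add_skewPart (p b : ℕ → ℝ) (x : ℕ → H) (n : ℕ) :
    symmPart p b x n + skewPart b x n = p (n + 1) • x (n + 1) + b n • x n := by
  simp only [symmPart, skewPart]
  module

theorem two_mul_inner_le_add_norm_sub_sq (s k y : H) :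
    2 * inner ℝ s k ≤ 2 * inner ℝ s y + ‖y - (s + k)‖ ^ 2 := by
  have hexpand : ‖y - (s + k)‖ ^ 2 = ‖y - k‖ ^ 2 - 2 * inner ℝ s (y - k) + ‖s‖ ^ 2 := by
    rw [show y - (s + k) = (y - k) - s by abel, norm_sub_sq_real, real_inner_comm s]
  rw [hexpand, inner_sub_right]
  nlinarith [sq_nonneg ‖y - k‖, sq_nonneg ‖s‖]

theorem sum_commutator_le {N : ℕ} (p b : ℕ → ℝ) {x : ℕ → H} (h₀ : x 0 = 0) (hN : x N = 0)
    (hN' : x (N + 1) = 0) :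
    ∑ i ∈ Finset.range N, (1 / 2 * (b (i + 1) ^ 2 - b i ^ 2) * ‖x (i + 1)‖ ^ 2
        + b (i + 1) * (p (i + 2) - p (i + 1)) * inner ℝ (x (i + 2)) (x (i + 1)))
      ≤ ∑ i ∈ Finset.range N, 2 * inner ℝ (symmPart p b x i) (skewPart b x i) := by
  let T (n : ℕ) : ℝ := p (n + 1) * b n * inner ℝ (x (n + 1)) (x n)
    + 1 / 2 * b n ^ 2 * (‖x n‖ ^ 2 + ‖x (n + 1)‖ ^ 2)
  have hT₀ : 0 ≤ T 0 := by
    simp only [T, h₀, inner_zero_right, mul_zero, zero_add]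
    positivity
  have hTN : T N = 0 := by simp [T, hN, hN']
  have hterm (i : ℕ) : 2 * inner ℝ (symmPart p b x i) (skewPart b x i) =
      1 / 2 * (b (i + 1) ^ 2 - b i ^ 2) * ‖x (i + 1)‖ ^ 2
        + b (i + 1) * (p (i + 2) - p (i + 1)) * inner ℝ (x (i + 2)) (x (i + 1))
        - (T (i + 1) - T i) := by
    simp only [T, symmPart, skewPart, ← real_inner_self_eq_norm_sq, inner_add_left,
      inner_sub_right, real_inner_smul_left, real_inner_smul_right, add_assoc, Nat.reduceAdd]
    rw [real_inner_comm (x i) (x (i + 2)), real_inner_comm (x (i + 1)) (x (i + 2))]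
    ring
  simp only [hterm, Finset.sum_sub_distrib _ (fun i => T (i + 1) - T i), Finset.sum_range_sub]
  linarith

theorem sum_two_mul_inner_symmPart {N : ℕ} (p b : ℕ → ℝ) {x : ℕ → H} (y : ℕ → H)
    (h₀ : x 0 = 0) (hN : x N = 0) :
    ∑ i ∈ Finset.range N, 2 * inner ℝ (symmPart p b x i) (y (i + 1)) =
      ∑ i ∈ Finset.range N, (2 * p (i + 1) * inner ℝ (x (i + 1)) (y (i + 1))
        + b (i + 1) * (inner ℝ (x (i + 2)) (y (i + 1)) + inner ℝ (y (i + 2)) (x (i + 1)))) := by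
  let T (n : ℕ) : ℝ := b n * inner ℝ (x n) (y (n + 1))
  have hterm (i : ℕ) : 2 * inner ℝ (symmPart p b x i) (y (i + 1)) =
      2 * p (i + 1) * inner ℝ (x (i + 1)) (y (i + 1))
        + b (i + 1) * (inner ℝ (x (i + 2)) (y (i + 1)) + inner ℝ (y (i + 2)) (x (i + 1)))
        - (T (i + 1) - T i) := by
    simp only [T, symmPart, inner_add_left, real_inner_smul_left, real_inner_comm _ (y _),
      add_assoc, Nat.reduceAdd]
    ring
  have hT : T N - T 0 = 0 := by simp [T, h₀, hN]
  simp only [hterm, Finset.sum_sub_distrib _ (fun i => T (i + 1) - T i), Finset.sum_range_sub, hT,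
    sub_zero]

/-- The positive commutator argument: `2 ⟪S, K⟫` sums to the commutator of the symmetric part `S`
and the skew part `K`, while `2 ⟪S, y⟫` is, for `y = x'`, the derivative of `⟪S x, x⟫` apart from
the terms containing `p'` and `b'`. -/
theorem carleman_sum_le {N : ℕ} (p b : ℕ → ℝ) {x : ℕ → H} (y : ℕ → H) (h₀ : x 0 = 0)
    (hN : x N = 0) (hN' : x (N + 1) = 0) :
    ∑ i ∈ Finset.range N, (1 / 2 * (b (i + 1) ^ 2 - b i ^ 2) * ‖x (i + 1)‖ ^ 2
        + b (i + 1) * (p (i + 2) - p (i + 1)) * inner ℝ (x (i + 2)) (x (i + 1)))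
      ≤ ∑ i ∈ Finset.range N, (2 * p (i + 1) * inner ℝ (x (i + 1)) (y (i + 1))
          + b (i + 1) * (inner ℝ (x (i + 2)) (y (i + 1)) + inner ℝ (y (i + 2)) (x (i + 1))))
        + ∑ i ∈ Finset.range N, ‖y (i + 1) - (p (i + 1) • x (i + 1) + b i • x i)‖ ^ 2 := by
  refine (sum_commutator_le p b h₀ hN hN').trans ?_
  rw [← sum_two_mul_inner_symmPart p b y h₀ hN, ← Finset.sum_add_distrib]
  refine Finset.sum_le_sum fun i _ => ?_
  rw [← symmPart_add_skewPart]
  exact two_mul_inner_le_add_norm_sub_sq _ _ _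

theorem neg_sum_le_two_mul_sum_inner {N : ℕ} (c : ℕ → ℝ) {x : ℕ → H} (hN : x (N + 1) = 0) :
    -∑ i ∈ Finset.range N, (|c (i + 1)| + |c i|) * ‖x (i + 1)‖ ^ 2
      ≤ 2 * ∑ i ∈ Finset.range N, c (i + 1) * inner ℝ (x (i + 2)) (x (i + 1)) := by
  let J (n : ℕ) : ℝ := |c n| * ‖x (n + 1)‖ ^ 2
  have hterm (i : ℕ) : -((|c (i + 1)| + |c i|) * ‖x (i + 1)‖ ^ 2) - (J (i + 1) - J i)
      ≤ 2 * (c (i + 1) * inner ℝ (x (i + 2)) (x (i + 1))) := by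
    have hinner : 2 * |inner ℝ (x (i + 2)) (x (i + 1))| ≤ ‖x (i + 2)‖ ^ 2 + ‖x (i + 1)‖ ^ 2 := by
      linarith [abs_real_inner_le_norm (x (i + 2)) (x (i + 1)),
        two_mul_le_add_sq ‖x (i + 2)‖ ‖x (i + 1)‖]
    have hscaled := mul_le_mul_of_nonneg_left hinner (abs_nonneg (c (i + 1)))
    have habs := neg_abs_le (c (i + 1) * inner ℝ (x (i + 2)) (x (i + 1)))
    rw [abs_mul] at habs
    simp only [J, add_assoc, Nat.reduceAdd]
    linarith
  have hJ₀ : 0 ≤ J 0 := by positivity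
  have hJN : J N = 0 := by simp [J, hN]
  have hsum := Finset.sum_le_sum fun i (_ : i ∈ Finset.range N) => hterm i
  rw [Finset.sum_sub_distrib, Finset.sum_neg_distrib, Finset.sum_range_sub,
    ← Finset.mul_sum] at hsum
  linarith

end Carleman

section Bell

variable {H : Type*} [NormedAddCommGroup H] [InnerProductSpace ℝ H]

/-- The base `ρ` of the Carleman weight. It solves `ρ' = σ ρ` with the linear slope
`σ = bellSlope`, and is largest at the midpoint of `[0, 1]`. -/
noncomputable def bellBase (t : ℝ) : ℝ := 2 / 3 * Real.exp (-(t - 1 / 2) ^ 2 / 16)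

/-- The logarithmic derivative `σ` of `bellBase`. -/
noncomputable def bellSlope (t : ℝ) : ℝ := -(t - 1 / 2) / 8

/-- The Carleman weight `(n + m)! ρ ^ (n + m)` on the `n`-th rung of a ladder, where `m` is the
large parameter of the Carleman inequality. -/
noncomputable def bellWeight (m n : ℕ) (t : ℝ) : ℝ := (n + m).factorial * bellBase t ^ (n + m)

/-- The logarithmic derivative of `bellWeight m n` at `t`. -/
noncomputable def bellRate (m : ℕ) (t : ℝ) (n : ℕ) : ℝ := (n + m) * bellSlope t

/-- The quotient of `bellWeight m (n + 1)` and `bellWeight m n` at `t`. -/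
noncomputable def bellRatio (m : ℕ) (t : ℝ) (n : ℕ) : ℝ := (n + m + 1) * bellBase t

theorem bellBase_pos (t : ℝ) : 0 < bellBase t := by unfold bellBase; positivity

theorem bellBase_le (t : ℝ) : bellBase t ≤ 2 / 3 := by
  have : Real.exp (-(t - 1 / 2) ^ 2 / 16) ≤ 1 :=
    Real.exp_le_one_iff.2 (by linarith [sq_nonneg (t - 1 / 2)])
  unfold bellBase
  linarith

theorem le_bellBase {t : ℝ} (ht : t ∈ Set.Icc (0 : ℝ) 1) : 5 / 8 ≤ bellBase t := by
  have hsq : (t - 1 / 2) ^ 2 ≤ 1 / 4 := by nlinarith [ht.1, ht.2]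
  unfold bellBase
  linarith [Real.add_one_le_exp (-(t - 1 / 2) ^ 2 / 16)]

theorem abs_bellSlope_le {t : ℝ} (ht : t ∈ Set.Icc (0 : ℝ) 1) : |bellSlope t| ≤ 1 / 16 := by
  unfold bellSlope
  rw [abs_le]
  constructor <;> linarith [ht.1, ht.2]

theorem hasDerivAt_bellSlope (t : ℝ) : HasDerivAt bellSlope (-(1 / 8)) t := by
  have h := (((hasDerivAt_id t).sub_const (1 / 2)).neg.div_const 8)
  exact h.congr_deriv (by norm_num)

theorem hasDerivAt_bellBase (t : ℝ) : HasDerivAt bellBase (bellSlope t * bellBase t) t := by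
  have h := ((((hasDerivAt_id t).sub_const (1 / 2)).pow 2).neg.div_const 16).exp.const_mul (2 / 3)
  refine h.congr_deriv ?_
  simp only [bellSlope, bellBase, id, Nat.cast_ofNat, Pi.neg_apply, Pi.pow_apply]
  ring

theorem bellWeight_pos (m n : ℕ) (t : ℝ) : 0 < bellWeight m n t := by
  have := bellBase_pos t
  unfold bellWeight
  positivity

theorem bellWeight_succ (m n : ℕ) (t : ℝ) :
    bellWeight m (n + 1) t = bellRatio m t n * bellWeight m n t := by
  rw [bellWeight, bellWeight, bellRatio, show n + 1 + m = n + m + 1 by ring, Nat.factorial_succ]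
  push_cast
  ring

theorem hasDerivAt_bellWeight (m n : ℕ) (t : ℝ) :
    HasDerivAt (bellWeight m n) (bellRate m t n * bellWeight m n t) t := by
  refine (((hasDerivAt_bellBase t).pow (n + m)).const_mul ((n + m).factorial : ℝ)).congr_deriv ?_
  rw [bellRate, bellWeight]
  rcases hk : n + m with _ | k
  · have hnm : (n : ℝ) + m = 0 := by exact_mod_cast hk
    simp [hnm]
  · have hnm : (n : ℝ) + m = k + 1 := by exact_mod_cast hk
    simp only [hnm, Nat.add_sub_cancel]
    push_cast
    ring

theorem bellRate_succ_sub (m n : ℕ) (t : ℝ) :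
    bellRate m t (n + 1) - bellRate m t n = bellSlope t := by
  simp only [bellRate]
  push_cast
  ring

theorem bell_commutator_ge (m n : ℕ) {t : ℝ} (ht : t ∈ Set.Icc (0 : ℝ) 1) :
    m / 8 ≤ -((n + 1 + m) / 8) + 1 / 2 * (bellRatio m t (n + 1) ^ 2 - bellRatio m t n ^ 2)
      - (|bellRatio m t (n + 1) * bellSlope t| + |bellRatio m t n * bellSlope t|) := by
  have hρ := le_bellBase ht
  have habs (k : ℕ) : |bellRatio m t k * bellSlope t| ≤ (k + m + 1) * bellBase t * (1 / 16) := by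
    rw [abs_mul, bellRatio, abs_of_nonneg (by positivity)]
    gcongr
    exact abs_bellSlope_le ht
  have hcur := habs n
  have hnext := habs (n + 1)
  have hquad : 0 ≤ (2 * (n + m + 1) + 1 : ℝ) * (8 * bellBase t ^ 2 - bellBase t - 2) :=
    mul_nonneg (by positivity) (by nlinarith)
  simp only [bellRatio] at *
  push_cast at *
  linarith

/-- The quadratic form `⟪S x, x⟫` of the symmetric part for the weighted curves
`x_n = bellWeight m n • z_n`, over the first `N` rungs. -/
noncomputable def bellFunctional (m N : ℕ) (z : ℕ → ℝ → H) (t : ℝ) : ℝ :=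
  ∑ i ∈ Finset.range N, (bellRate m t (i + 1) * ‖bellWeight m (i + 1) t • z (i + 1) t‖ ^ 2
    + bellRatio m t (i + 1) *
      inner ℝ (bellWeight m (i + 2) t • z (i + 2) t) (bellWeight m (i + 1) t • z (i + 1) t))

theorem hasDerivAt_bellFunctional {z : ℕ → ℝ → H} {m N : ℕ} {x y : ℕ → H} {t : ℝ}
    (hx : ∀ n, bellWeight m n t • z n t = x n)
    (hy : ∀ n, HasDerivAt (fun s => bellWeight m n s • z n s) (y n) t) :
    HasDerivAt (bellFunctional m N z)
      (∑ i ∈ Finset.range N, (-((i + 1 + m) / 8) * ‖x (i + 1)‖ ^ 2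
        + bellRatio m t (i + 1) * bellSlope t * inner ℝ (x (i + 2)) (x (i + 1))
        + (2 * bellRate m t (i + 1) * inner ℝ (x (i + 1)) (y (i + 1))
          + bellRatio m t (i + 1) *
            (inner ℝ (x (i + 2)) (y (i + 1)) + inner ℝ (y (i + 2)) (x (i + 1)))))) t := by
  refine HasDerivAt.fun_sum fun i _ => ?_
  have hrate : HasDerivAt (fun s => bellRate m s (i + 1)) (-((i + 1 + m) / 8)) t :=
    ((hasDerivAt_bellSlope t).const_mul _).congr_deriv (by push_cast; ring)
  have hratio : HasDerivAt (fun s => bellRatio m s (i + 1))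
      (bellRatio m t (i + 1) * bellSlope t) t :=
    ((hasDerivAt_bellBase t).const_mul _).congr_deriv (by rw [bellRatio]; ring)
  refine ((hrate.mul (hy (i + 1)).norm_sq).add
    (hratio.mul ((hy (i + 2)).inner ℝ (hy (i + 1))))).congr_deriv ?_
  simp only [hx]
  ring

theorem exists_deriv_bellFunctional_ge {z z' : ℕ → ℝ → H} (m : ℕ) {N : ℕ} {t : ℝ}
    (ht : t ∈ Set.Icc (0 : ℝ) 1) (hz : ∀ n, HasDerivAt (z n) (z' n t) t) (h₀ : z 0 t = 0)
    (hN : z N t = 0) (hN' : z (N + 1) t = 0) :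
    ∃ D, HasDerivAt (bellFunctional m N z) D t ∧
      m / 8 * ∑ i ∈ Finset.range N, bellWeight m (i + 1) t ^ 2 * ‖z (i + 1) t‖ ^ 2
        ≤ D + ∑ i ∈ Finset.range N,
          bellWeight m (i + 1) t ^ 2 * ‖z' (i + 1) t - z i t‖ ^ 2 := by
  let x (n : ℕ) : H := bellWeight m n t • z n t
  let y (n : ℕ) : H := bellRate m t n • x n + bellWeight m n t • z' n t
  have hy (n : ℕ) : HasDerivAt (fun s => bellWeight m n s • z n s) (y n) t :=
    ((hasDerivAt_bellWeight m n t).smul (hz n)).congr_deriv (by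
      simp only [y, x, smul_smul]; exact add_comm _ _)
  have hnorm (n : ℕ) (v : H) : ‖bellWeight m n t • v‖ ^ 2 = bellWeight m n t ^ 2 * ‖v‖ ^ 2 := by
    rw [norm_smul, mul_pow, Real.norm_eq_abs, sq_abs]
  have hxnorm (n : ℕ) : ‖x n‖ ^ 2 = bellWeight m n t ^ 2 * ‖z n t‖ ^ 2 := hnorm n _
  have hresidual (i : ℕ) :
      y (i + 1) - (bellRate m t (i + 1) • x (i + 1) + bellRatio m t i • x i)
        = bellWeight m (i + 1) t • (z' (i + 1) t - z i t) := by
    simp only [y, x, bellWeight_succ m i, smul_sub, smul_smul]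
    abel
  have hcommutator := carleman_sum_le (N := N) (bellRate m t) (bellRatio m t) (x := x) y
    (by simp [x, h₀]) (by simp [x, hN]) (by simp [x, hN'])
  have hcross := neg_sum_le_two_mul_sum_inner (N := N)
    (fun n => bellRatio m t n * bellSlope t) (x := x) (by simp [x, hN'])
  have hbound := Finset.sum_le_sum fun i (_ : i ∈ Finset.range N) =>
    mul_le_mul_of_nonneg_right (bell_commutator_ge m i ht) (sq_nonneg ‖x (i + 1)‖)
  refine ⟨_, hasDerivAt_bellFunctional (x := x) (fun n => rfl) hy, ?_⟩
  simp only [hresidual, bellRate_succ_sub m (_ + 1), hnorm, hxnorm, add_mul, sub_mul,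
    Finset.sum_add_distrib, Finset.sum_sub_distrib, ← Finset.mul_sum] at hcommutator hcross hbound ⊢
  linarith

theorem bellWeight_le_succ {m : ℕ} (hm : 1 ≤ m) (n : ℕ) {t : ℝ} (ht : t ∈ Set.Icc (0 : ℝ) 1) :
    bellWeight m n t ≤ bellWeight m (n + 1) t := by
  rw [bellWeight_succ]
  refine le_mul_of_one_le_left (bellWeight_pos m n t).le ?_
  have hm' : (1 : ℝ) ≤ m := by exact_mod_cast hm
  rw [bellRatio]
  nlinarith [le_bellBase ht, (n.cast_nonneg : (0 : ℝ) ≤ n)]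

theorem bellWeight_le_of_abs_le {s t : ℝ} (h : |s - 1 / 2| ≤ |t - 1 / 2|) (m n : ℕ) :
    bellWeight m n t ≤ bellWeight m n s := by
  have hsq := sq_le_sq.2 h
  have := bellBase_pos t
  unfold bellWeight bellBase at *
  gcongr

theorem continuousOn_bellFunctional {z : ℕ → ℝ → H} {s : Set ℝ} (hz : ∀ n, ContinuousOn (z n) s)
    (m N : ℕ) : ContinuousOn (bellFunctional m N z) s := by
  have hslope : Continuous bellSlope :=
    continuous_iff_continuousAt.2 fun t => (hasDerivAt_bellSlope t).continuousAt
  have hbase : Continuous bellBase :=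
    continuous_iff_continuousAt.2 fun t => (hasDerivAt_bellBase t).continuousAt
  unfold bellFunctional bellRate bellRatio bellWeight
  fun_prop

theorem abs_bellFunctional_term_le {z : ℕ → ℝ → H} {m : ℕ} {K t : ℝ}
    (ht : t ∈ Set.Icc (0 : ℝ) 1) (hz : ∀ n, ‖bellWeight m n t • z n t‖ ≤ K * (1 / 2) ^ n) (i : ℕ) :
    |bellRate m t (i + 1) * ‖bellWeight m (i + 1) t • z (i + 1) t‖ ^ 2
      + bellRatio m t (i + 1) *
        inner ℝ (bellWeight m (i + 2) t • z (i + 2) t) (bellWeight m (i + 1) t • z (i + 1) t)|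
      ≤ (m + 1) / 4 * K ^ 2 * (1 / 2) ^ i := by
  have hrate : |bellRate m t (i + 1)| ≤ (i + 1 + m) * (1 / 16) := by
    rw [bellRate, abs_mul, abs_of_nonneg (by positivity)]
    push_cast
    gcongr
    exact abs_bellSlope_le ht
  have hratio : |bellRatio m t (i + 1)| ≤ (i + 2 + m) * (2 / 3) := by
    have := bellBase_pos t
    rw [bellRatio, abs_of_nonneg (by positivity)]
    push_cast
    nlinarith [bellBase_le t]
  have hi : (i + 2 + m : ℝ) ≤ 2 * (m + 1) * 2 ^ i := by
    have : (i + 1 : ℝ) ≤ 2 ^ i := by exact_mod_cast i.lt_two_pow_self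
    nlinarith [(m.cast_nonneg : (0 : ℝ) ≤ m)]
  calc _ ≤ (i + 1 + m) * (1 / 16) * (K * (1 / 2) ^ (i + 1)) ^ 2
        + (i + 2 + m) * (2 / 3) * ((K * (1 / 2) ^ (i + 2)) * (K * (1 / 2) ^ (i + 1))) := by
        refine (abs_add_le _ _).trans ?_
        rw [abs_mul, abs_mul, abs_of_nonneg (sq_nonneg ‖_‖)]
        gcongr
        · exact hz _
        · refine (abs_real_inner_le_norm _ _).trans ?_
          gcongr
          exacts [(norm_nonneg _).trans (hz _), hz _, hz _]
    _ ≤ (i + 2 + m) * (K ^ 2 * ((1 / 2) ^ i * (1 / 2) ^ i) * (1 / 8)) := by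
        have hs : (i + 1 + m) * (1 / 16) * (1 / 4) + (i + 2 + m) * (2 / 3) * (1 / 8)
            ≤ (i + 2 + m : ℝ) * (1 / 8) := by
          have : (0 : ℝ) ≤ i + m := by positivity
          linarith
        have := mul_le_mul_of_nonneg_left hs
          (by positivity : 0 ≤ K ^ 2 * ((1 / 2) ^ i * (1 / 2) ^ i))
        linear_combination this
    _ ≤ 2 * (m + 1) * 2 ^ i * (K ^ 2 * ((1 / 2) ^ i * (1 / 2) ^ i) * (1 / 8)) := by gcongr
    _ = (m + 1) / 4 * K ^ 2 * (1 / 2) ^ i := by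
        rw [one_div, inv_pow]; field_simp; ring

theorem abs_bellFunctional_le {z : ℕ → ℝ → H} {m : ℕ} {K t : ℝ} (ht : t ∈ Set.Icc (0 : ℝ) 1)
    (hz : ∀ n, ‖bellWeight m n t • z n t‖ ≤ K * (1 / 2) ^ n) (N : ℕ) :
    |bellFunctional m N z t| ≤ (m + 1) / 2 * K ^ 2 := by
  calc |bellFunctional m N z t|
      ≤ ∑ i ∈ Finset.range N, (m + 1) / 4 * K ^ 2 * (1 / 2) ^ i :=
        (Finset.abs_sum_le_sum_abs _ _).trans (Finset.sum_le_sum fun i _ =>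
          abs_bellFunctional_term_le ht hz i)
    _ ≤ (m + 1) / 4 * K ^ 2 * 2 := by
        rw [← Finset.mul_sum]
        gcongr
        exact sum_geometric_two_le N
    _ = (m + 1) / 2 * K ^ 2 := by ring

end Bell

section Truncation

variable {E : Type*} [NormedAddCommGroup E]

/-- The rungs `1, …, N` of a ladder, with all other rungs replaced by zero. -/
noncomputable def truncate (N : ℕ) (v : ℕ → ℝ → E) : ℕ → ℝ → E := (Set.Icc 1 N).indicator v

theorem truncate_of_mem {N n : ℕ} (hn : n ∈ Set.Icc 1 N) (v : ℕ → ℝ → E) :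
    truncate N v n = v n := Set.indicator_of_mem hn v

theorem truncate_of_notMem {N n : ℕ} (hn : n ∉ Set.Icc 1 N) (v : ℕ → ℝ → E) :
    truncate N v n = 0 := Set.indicator_of_notMem hn v

theorem norm_truncate_le (N n : ℕ) (v : ℕ → ℝ → E) (t : ℝ) : ‖truncate N v n t‖ ≤ ‖v n t‖ := by
  by_cases hn : n ∈ Set.Icc 1 N
  · rw [truncate_of_mem hn]
  · simp [truncate_of_notMem hn]

theorem continuousOn_truncate {v : ℕ → ℝ → E} {s : Set ℝ} (hv : ∀ n, ContinuousOn (v n) s)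
    (N n : ℕ) : ContinuousOn (truncate N v n) s := by
  by_cases hn : n ∈ Set.Icc 1 N
  · rw [truncate_of_mem hn]
    exact hv n
  · rw [truncate_of_notMem hn]
    exact continuousOn_const

theorem hasDerivAt_truncate [NormedSpace ℝ E] {v v' : ℕ → ℝ → E} {t : ℝ}
    (hv : ∀ n, HasDerivAt (v n) (v' n t) t) (N n : ℕ) :
    HasDerivAt (truncate N v n) (truncate N v' n t) t := by
  by_cases hn : n ∈ Set.Icc 1 N
  · rw [truncate_of_mem hn, truncate_of_mem hn]
    exact hv n
  · rw [truncate_of_notMem hn, truncate_of_notMem hn]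
    exact hasDerivAt_const t 0

end Truncation

section LadderCarleman

variable {H : Type*} [NormedAddCommGroup H] [InnerProductSpace ℝ H] {A τ : ℝ}
  {v v' : ℕ → ℝ → H}

theorem IsLadder.norm_deriv_sub_sq_le (hv : IsLadder A τ v v') (n : ℕ) {t : ℝ}
    (ht : t ∈ Set.Ioo (0 : ℝ) 1) (x : H) :
    ‖v' (n + 1) t - x‖ ^ 2
      ≤ 3 * (‖v n t - x‖ ^ 2 + τ ^ 2 * ‖v (n + 2) t‖ ^ 2 + A ^ 2 * ‖v (n + 1) t‖ ^ 2) := by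
  have htriangle : ‖v' (n + 1) t - x‖ ≤ ‖v n t - x‖ + ‖τ • v (n + 2) t‖ + A * ‖v (n + 1) t‖ := by
    calc ‖v' (n + 1) t - x‖
        = ‖(v n t - x) + τ • v (n + 2) t + (v' (n + 1) t - v n t - τ • v (n + 2) t)‖ := by
          congr 1; abel
      _ ≤ _ := norm_add₃_le.trans (by gcongr; exact hv.residual_le n t ht)
  have hτ : ‖τ • v (n + 2) t‖ ^ 2 = τ ^ 2 * ‖v (n + 2) t‖ ^ 2 := by
    rw [norm_smul, mul_pow, Real.norm_eq_abs, sq_abs]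
  rw [← hτ, ← mul_pow A]
  refine (pow_le_pow_left₀ (norm_nonneg _) htriangle 2).trans ?_
  linarith [sq_nonneg (‖v n t - x‖ - ‖τ • v (n + 2) t‖),
    sq_nonneg (‖v n t - x‖ - A * ‖v (n + 1) t‖),
    sq_nonneg (‖τ • v (n + 2) t‖ - A * ‖v (n + 1) t‖)]

theorem sum_bellWeight_mul_sub_truncate_le {E : Type*} [NormedAddCommGroup E] (m N : ℕ)
    (v : ℕ → ℝ → E) (t : ℝ) :
    ∑ i ∈ Finset.range N, bellWeight m (i + 1) t ^ 2 * ‖v i t - truncate N v i t‖ ^ 2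
      ≤ bellWeight m 1 t ^ 2 * ‖v 0 t‖ ^ 2 := by
  calc _ ≤ ∑ i ∈ Finset.range N, if i = 0 then bellWeight m 1 t ^ 2 * ‖v 0 t‖ ^ 2 else 0 := by
        refine Finset.sum_le_sum fun i hi => ?_
        split_ifs with h
        · simp [h, truncate_of_notMem]
        · rw [truncate_of_mem ⟨Nat.pos_of_ne_zero h, (Finset.mem_range.1 hi).le⟩]
          simp
    _ ≤ _ := by
        rw [Finset.sum_ite_eq']
        split_ifs
        · rfl
        · positivity

theorem sum_bellWeight_mul_add_two_le {E : Type*} [NormedAddCommGroup E] {m : ℕ} (hm : 1 ≤ m)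
    (N : ℕ) (v : ℕ → ℝ → E) {t : ℝ} (ht : t ∈ Set.Icc (0 : ℝ) 1) :
    ∑ i ∈ Finset.range N, bellWeight m (i + 1) t ^ 2 * ‖v (i + 2) t‖ ^ 2
      ≤ ∑ i ∈ Finset.range N, bellWeight m (i + 1) t ^ 2 * ‖v (i + 1) t‖ ^ 2
        + bellWeight m (N + 1) t ^ 2 * ‖v (N + 1) t‖ ^ 2 := by
  calc _ ≤ ∑ i ∈ Finset.range N, bellWeight m (i + 2) t ^ 2 * ‖v (i + 2) t‖ ^ 2 := by
        gcongr with i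
        exacts [(bellWeight_pos m (i + 1) t).le, bellWeight_le_succ hm (i + 1) ht]
    _ ≤ ∑ i ∈ Finset.range (N + 1), bellWeight m (i + 1) t ^ 2 * ‖v (i + 1) t‖ ^ 2 := by
        rw [Finset.sum_range_succ']
        exact le_add_of_nonneg_right (by positivity)
    _ = _ := Finset.sum_range_succ _ N

theorem IsLadder.sum_residual_truncate_le (hv : IsLadder A τ v v') {m : ℕ} (hm : 1 ≤ m) (N : ℕ)
    {t : ℝ} (ht : t ∈ Set.Ioo (0 : ℝ) 1) :
    ∑ i ∈ Finset.range (N + 1), bellWeight m (i + 1) t ^ 2 *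
        ‖truncate N v' (i + 1) t - truncate N v i t‖ ^ 2
      ≤ 3 * (A ^ 2 + τ ^ 2) *
          ∑ i ∈ Finset.range N, bellWeight m (i + 1) t ^ 2 * ‖v (i + 1) t‖ ^ 2
        + 3 * (bellWeight m 1 t ^ 2 * ‖v 0 t‖ ^ 2)
        + (3 * τ ^ 2 * (bellWeight m (N + 1) t ^ 2 * ‖v (N + 1) t‖ ^ 2)
          + bellWeight m (N + 1) t ^ 2 * ‖v N t‖ ^ 2) := by
  have hlast : ‖truncate N v' (N + 1) t - truncate N v N t‖ ^ 2 ≤ ‖v N t‖ ^ 2 := by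
    rw [truncate_of_notMem (by simp), Pi.zero_apply, zero_sub, norm_neg]
    gcongr
    exact norm_truncate_le N N v t
  have hterm : ∀ i ∈ Finset.range N, bellWeight m (i + 1) t ^ 2 *
      ‖truncate N v' (i + 1) t - truncate N v i t‖ ^ 2
      ≤ 3 * (bellWeight m (i + 1) t ^ 2 * ‖v i t - truncate N v i t‖ ^ 2)
        + 3 * τ ^ 2 * (bellWeight m (i + 1) t ^ 2 * ‖v (i + 2) t‖ ^ 2)
        + 3 * A ^ 2 * (bellWeight m (i + 1) t ^ 2 * ‖v (i + 1) t‖ ^ 2) := by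
    intro i hi
    rw [truncate_of_mem ⟨by lia, by simpa using hi⟩]
    have := mul_le_mul_of_nonneg_left (hv.norm_deriv_sub_sq_le i ht (truncate N v i t))
      (sq_nonneg (bellWeight m (i + 1) t))
    linarith
  have hsum := Finset.sum_le_sum hterm
  simp only [Finset.sum_add_distrib, ← Finset.mul_sum] at hsum
  have hfirst := sum_bellWeight_mul_sub_truncate_le m N v t
  have hshift := mul_le_mul_of_nonneg_left
    (sum_bellWeight_mul_add_two_le hm N v (Set.Ioo_subset_Icc_self ht))
    (by positivity : 0 ≤ 3 * τ ^ 2)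
  rw [Finset.sum_range_succ]
  have := mul_le_mul_of_nonneg_left hlast (sq_nonneg (bellWeight m (N + 1) t))
  linarith

theorem IsLadder.exists_deriv_truncate_ge (hv : IsLadder A τ v v') {m : ℕ} (hm : 1 ≤ m)
    (N : ℕ) {t : ℝ} (ht : t ∈ Set.Ioo (0 : ℝ) 1) :
    ∃ D, HasDerivAt (bellFunctional m (N + 1) (truncate N v)) D t ∧
      (m / 8 - 3 * (A ^ 2 + τ ^ 2)) *
          ∑ i ∈ Finset.range N, bellWeight m (i + 1) t ^ 2 * ‖v (i + 1) t‖ ^ 2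
        ≤ D + 3 * (bellWeight m 1 t ^ 2 * ‖v 0 t‖ ^ 2)
        + (3 * τ ^ 2 * (bellWeight m (N + 1) t ^ 2 * ‖v (N + 1) t‖ ^ 2)
          + bellWeight m (N + 1) t ^ 2 * ‖v N t‖ ^ 2) := by
  have hzero (n : ℕ) (hn : n ∉ Set.Icc 1 N) : truncate N v n t = 0 := by
    rw [truncate_of_notMem hn, Pi.zero_apply]
  obtain ⟨D, hD, hle⟩ := exists_deriv_bellFunctional_ge m (N := N + 1)
    (Set.Ioo_subset_Icc_self ht) (hasDerivAt_truncate (fun n => hv.hasDerivAt n t ht) N)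
    (hzero 0 (by simp)) (hzero (N + 1) (by simp)) (hzero (N + 2) (by simp))
  refine ⟨D, hD, ?_⟩
  have hsum : ∑ i ∈ Finset.range (N + 1),
      bellWeight m (i + 1) t ^ 2 * ‖truncate N v (i + 1) t‖ ^ 2
      = ∑ i ∈ Finset.range N, bellWeight m (i + 1) t ^ 2 * ‖v (i + 1) t‖ ^ 2 := by
    rw [Finset.sum_range_succ, hzero (N + 1) (by simp), norm_zero, zero_pow two_ne_zero, mul_zero,
      add_zero]
    exact Finset.sum_congr rfl fun i hi => by
      rw [truncate_of_mem ⟨by lia, by simpa using hi⟩]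
  rw [hsum] at hle
  linarith [hv.sum_residual_truncate_le hm N ht]

theorem factorial_add_mul_pow_le {a b : ℝ} (ha : 0 ≤ a) (hb : 0 ≤ b) (hab : a + b = 1)
    (n m : ℕ) : (n + m).factorial * (a ^ n * b ^ m) ≤ n.factorial * m.factorial := by
  have hbinom : a ^ n * b ^ m * (n + m).choose n ≤ 1 := by
    calc a ^ n * b ^ m * (n + m).choose n
        = a ^ n * b ^ (n + m - n) * (n + m).choose n := by rw [Nat.add_sub_cancel_left]
      _ ≤ ∑ k ∈ Finset.range (n + m + 1), a ^ k * b ^ (n + m - k) * (n + m).choose k :=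
        Finset.single_le_sum (f := fun k => a ^ k * b ^ (n + m - k) * ((n + m).choose k : ℝ))
          (fun k _ => by positivity) (Finset.mem_range.2 (by lia))
      _ = 1 := by rw [← add_pow, hab, one_pow]
  have hchoose : ((n + m).factorial : ℝ) = (n + m).choose n * n.factorial * m.factorial := by
    rw [← Nat.add_choose_mul_factorial_mul_factorial n m, ← Nat.choose_symm_add]
    push_cast
    ring
  rw [hchoose]
  have := mul_le_mul_of_nonneg_right hbinom
    (by positivity : (0 : ℝ) ≤ n.factorial * m.factorial)
  linarith

theorem bellWeight_mul_le {a b r c t x : ℝ} (ha : 0 < a) (hb : 0 < b) (hab : a + b = 1)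
    {n : ℕ} (hx₀ : 0 ≤ x) (hx : n.factorial * x ≤ c * r ^ n) (m : ℕ) :
    bellWeight m n t * x ≤ c * (m.factorial * (bellBase t / b) ^ m) * (r * bellBase t / a) ^ n := by
  have hρ := bellBase_pos t
  have hfac : ((n + m).factorial : ℝ) ≤ n.factorial * m.factorial / (a ^ n * b ^ m) := by
    rw [le_div_iff₀ (by positivity)]
    exact factorial_add_mul_pow_le ha.le hb.le hab n m
  calc bellWeight m n t * x
      ≤ n.factorial * m.factorial / (a ^ n * b ^ m) * bellBase t ^ (n + m) * x := by
        unfold bellWeight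
        gcongr
    _ = n.factorial * x * (m.factorial / (a ^ n * b ^ m) * bellBase t ^ (n + m)) := by ring
    _ ≤ c * r ^ n * (m.factorial / (a ^ n * b ^ m) * bellBase t ^ (n + m)) := by gcongr
    _ = _ := by rw [pow_add]; simp only [div_pow, mul_pow]; field_simp

theorem norm_bellWeight_smul_le_of_endpoint {E : Type*} [NormedAddCommGroup E] [NormedSpace ℝ E]
    {C t : ℝ} {x : ℕ → E} (hC : 0 ≤ C) (hx : ∀ n : ℕ, n.factorial * 256 ^ n * ‖x n‖ ≤ C)
    (m n : ℕ) :
    ‖bellWeight m n t • x n‖ ≤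
      C * (m.factorial * (128 / 127 * bellBase t) ^ m) * (1 / 2) ^ n := by
  have hρ := bellBase_pos t
  have hx' : n.factorial * ‖x n‖ ≤ C * (1 / 256) ^ n := by
    rw [one_div, inv_pow, ← div_eq_mul_inv, le_div_iff₀ (by positivity)]
    linarith [hx n]
  rw [norm_smul, Real.norm_of_nonneg (bellWeight_pos m n t).le]
  refine (bellWeight_mul_le (a := 1 / 128) (b := 127 / 128) (by norm_num) (by norm_num)
    (by norm_num) (norm_nonneg _) hx' m).trans ?_
  have hratio : 1 / 256 * bellBase t / (1 / 128) ≤ 1 / 2 := by linarith [bellBase_le t]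
  rw [show bellBase t / (127 / 128) = 128 / 127 * bellBase t by ring]
  gcongr

theorem exists_bellWeight_mul_le_geometric {c r : ℝ} (hr₀ : 0 ≤ r) (hr : r ≤ 11 / 8) {E : Type*}
    [NormedAddCommGroup E] {v : ℕ → ℝ → E}
    (hv : ∀ n : ℕ, ∀ t ∈ Set.Icc (0 : ℝ) 1, n.factorial * ‖v n t‖ ≤ c * r ^ n) (m : ℕ) :
    ∃ K, ∀ n : ℕ, ∀ t ∈ Set.Icc (0 : ℝ) 1, bellWeight m n t * ‖v n t‖ ≤ K * (22 / 23) ^ n := by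
  have hc : 0 ≤ c := (norm_nonneg _).trans (by simpa using hv 0 0 (by simp))
  refine ⟨c * (m.factorial * 16 ^ m), fun n t ht => ?_⟩
  have hρ := bellBase_pos t
  have hρ' := bellBase_le t
  have hratio : r * bellBase t / (23 / 24) ≤ 22 / 23 := by nlinarith
  refine (bellWeight_mul_le (a := 23 / 24) (b := 1 / 24) (by norm_num) (by norm_num)
    (by norm_num) (norm_nonneg _) (hv n t ht) m).trans ?_
  gcongr
  linarith

theorem eventually_tail_le {c r : ℝ} (hr₀ : 0 ≤ r) (hr : r ≤ 11 / 8) {E : Type*}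
    [NormedAddCommGroup E] {v : ℕ → ℝ → E}
    (hv : ∀ n : ℕ, ∀ t ∈ Set.Icc (0 : ℝ) 1, n.factorial * ‖v n t‖ ≤ c * r ^ n) (m : ℕ) (τ : ℝ)
    {ε : ℝ} (hε : 0 < ε) :
    ∀ᶠ N in Filter.atTop, ∀ t ∈ Set.Icc (0 : ℝ) 1,
      3 * τ ^ 2 * (bellWeight m (N + 1) t ^ 2 * ‖v (N + 1) t‖ ^ 2)
        + bellWeight m (N + 1) t ^ 2 * ‖v N t‖ ^ 2 ≤ ε := by
  obtain ⟨K, hK⟩ := exists_bellWeight_mul_le_geometric hr₀ hr hv m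
  obtain ⟨K', hK'⟩ := exists_bellWeight_mul_le_geometric hr₀ hr hv (m + 1)
  have hpow : Filter.Tendsto (fun N : ℕ => ((22 / 23 : ℝ)) ^ N) Filter.atTop (nhds 0) :=
    tendsto_pow_atTop_nhds_zero_of_lt_one (by norm_num) (by norm_num)
  have hlim : Filter.Tendsto (fun N => 3 * τ ^ 2 * (K * (22 / 23) ^ (N + 1)) ^ 2
      + (K' * (22 / 23) ^ N) ^ 2) Filter.atTop (nhds 0) := by
    simpa using (((((Filter.tendsto_add_atTop_iff_nat 1).2 hpow).const_mul K).pow 2).const_mul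
      (3 * τ ^ 2)).add ((hpow.const_mul K').pow 2)
  filter_upwards [hlim.eventually_le_const hε] with N hN t ht
  refine le_trans ?_ hN
  have hshift : bellWeight m (N + 1) t = bellWeight (m + 1) N t := by
    simp only [bellWeight, add_assoc, add_comm 1]
  have hnonneg (x : E) : 0 ≤ bellWeight m (N + 1) t * ‖x‖ :=
    mul_nonneg (bellWeight_pos m (N + 1) t).le (norm_nonneg x)
  rw [← mul_pow, ← mul_pow]
  exact add_le_add
    (mul_le_mul_of_nonneg_left (pow_le_pow_left₀ (hnonneg _) (hK (N + 1) t ht) 2) (by positivity))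
    (pow_le_pow_left₀ (hnonneg _) (hshift ▸ hK' N t ht) 2)

theorem mul_sub_le_sub_of_forall_exists_deriv_ge {F : ℝ → ℝ} {c a b : ℝ} (hab : a ≤ b)
    (hF : ContinuousOn F (Set.Icc a b))
    (hF' : ∀ t ∈ Set.Ioo a b, ∃ D, HasDerivAt F D t ∧ c ≤ D) : c * (b - a) ≤ F b - F a := by
  refine (convex_Icc a b).mul_sub_le_image_sub_of_le_deriv hF ?_ ?_ a (Set.left_mem_Icc.2 hab) b
    (Set.right_mem_Icc.2 hab) hab
  all_goals
    intro t ht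
    rw [interior_Icc] at ht
    obtain ⟨D, hD, hcD⟩ := hF' t ht
  · exact hD.differentiableAt.differentiableWithinAt
  · rwa [hD.deriv]

theorem two_mul_sub_le_sub_of_deriv_ge_near_half {F : ℝ → ℝ} {η p Q : ℝ} (hη : 0 ≤ η)
    (hη' : η ≤ 1 / 2) (hF : ContinuousOn F (Set.Icc 0 1))
    (hF' : ∀ t ∈ Set.Ioo (0 : ℝ) 1, ∃ D, HasDerivAt F D t ∧
      (|t - 1 / 2| ≤ η → Q ≤ D) ∧ (η ≤ |t - 1 / 2| → -p ≤ D)) :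
    2 * η * Q - (1 - 2 * η) * p ≤ F 1 - F 0 := by
  have hleft := mul_sub_le_sub_of_forall_exists_deriv_ge (F := F) (c := -p) (a := 0)
    (b := 1 / 2 - η) (by linarith) (hF.mono (Set.Icc_subset_Icc_right (by linarith)))
    fun t ht => by
      obtain ⟨D, hD, -, hfar⟩ := hF' t ⟨ht.1, by linarith [ht.2]⟩
      exact ⟨D, hD, hfar (le_abs.2 (.inr (by linarith [ht.2])))⟩
  have hmiddle := mul_sub_le_sub_of_forall_exists_deriv_ge (F := F) (c := Q) (a := 1 / 2 - η)
    (b := 1 / 2 + η) (by linarith) (hF.mono (Set.Icc_subset_Icc (by linarith) (by linarith)))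
    fun t ht => by
      obtain ⟨D, hD, hnear, -⟩ := hF' t ⟨by linarith [ht.1], by linarith [ht.2]⟩
      exact ⟨D, hD, hnear (abs_le.2 ⟨by linarith [ht.1], by linarith [ht.2]⟩)⟩
  have hright := mul_sub_le_sub_of_forall_exists_deriv_ge (F := F) (c := -p) (a := 1 / 2 + η)
    (b := 1) (by linarith) (hF.mono (Set.Icc_subset_Icc_left (by linarith)))
    fun t ht => by
      obtain ⟨D, hD, -, hfar⟩ := hF' t ⟨by linarith [ht.1], ht.2⟩
      exact ⟨D, hD, hfar (le_abs.2 (.inl (by linarith [ht.1])))⟩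
  linarith

theorem IsLadder.exists_deriv_truncate_ge_rung_one (hv : IsLadder A τ v v') {m N : ℕ}
    (hm : 1 ≤ m) (hmA : 3 * (A ^ 2 + τ ^ 2) ≤ m / 8) (hN : 1 ≤ N) {M ε t : ℝ}
    (ht : t ∈ Set.Ioo (0 : ℝ) 1) (hM : ‖v 0 t‖ ≤ M)
    (htail : 3 * τ ^ 2 * (bellWeight m (N + 1) t ^ 2 * ‖v (N + 1) t‖ ^ 2)
      + bellWeight m (N + 1) t ^ 2 * ‖v N t‖ ^ 2 ≤ ε) :
    ∃ D, HasDerivAt (bellFunctional m (N + 1) (truncate N v)) D t ∧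
      bellWeight m 1 t ^ 2 * ((m / 8 - 3 * (A ^ 2 + τ ^ 2)) * ‖v 1 t‖ ^ 2 - 3 * M ^ 2) - ε ≤ D := by
  obtain ⟨D, hD, hle⟩ := hv.exists_deriv_truncate_ge hm N ht
  refine ⟨D, hD, ?_⟩
  have hfirst : bellWeight m 1 t ^ 2 * ‖v 1 t‖ ^ 2
      ≤ ∑ i ∈ Finset.range N, bellWeight m (i + 1) t ^ 2 * ‖v (i + 1) t‖ ^ 2 :=
    Finset.single_le_sum (f := fun i => bellWeight m (i + 1) t ^ 2 * ‖v (i + 1) t‖ ^ 2)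
      (fun i _ => by positivity) (Finset.mem_range.2 hN)
  have hM' : bellWeight m 1 t ^ 2 * ‖v 0 t‖ ^ 2 ≤ bellWeight m 1 t ^ 2 * M ^ 2 := by gcongr
  linarith [mul_le_mul_of_nonneg_left hfirst (sub_nonneg.2 hmA)]

theorem mul_bellBase_zero_le {t : ℝ} (ht : |t - 1 / 2| ≤ 1 / 4) :
    128 / 127 * bellBase 0 ≤ bellBase t := by
  have hsq : (t - 1 / 2) ^ 2 ≤ (1 / 4) ^ 2 := sq_le_sq' (abs_le.1 ht).1 (abs_le.1 ht).2
  have hexp : 128 / 127 * Real.exp (-(1 / 64)) ≤ Real.exp (-(t - 1 / 2) ^ 2 / 16) := by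
    calc 128 / 127 * Real.exp (-(1 / 64))
        ≤ Real.exp (3 / 256) * Real.exp (-(1 / 64)) := by
          gcongr
          linarith [Real.add_one_le_exp (3 / 256)]
      _ = Real.exp (-(1 / 256)) := by rw [← Real.exp_add]; norm_num
      _ ≤ Real.exp (-(t - 1 / 2) ^ 2 / 16) := Real.exp_le_exp.2 (by linarith)
  unfold bellBase
  norm_num at hexp ⊢
  linarith

theorem bellBase_one : bellBase 1 = bellBase 0 := by norm_num [bellBase]

/-- The constants `1 / 256` in the endpoint decay and `1 / 4` in `mul_bellBase_zero_le` are matched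
so that the endpoint contribution is beaten by `bellWeight m 1` near the midpoint. -/
theorem abs_bellFunctional_truncate_le {C s t : ℝ} (hC : 0 ≤ C)
    (hx : ∀ n : ℕ, n.factorial * 256 ^ n * ‖v n s‖ ≤ C) (hs : s = 0 ∨ s = 1)
    (ht : |t - 1 / 2| ≤ 1 / 4) (m N N' : ℕ) :
    |bellFunctional m N' (truncate N v) s| ≤
      (m + 1) / 2 * (C * (m.factorial * bellBase t ^ m)) ^ 2 := by
  have hs' : s ∈ Set.Icc (0 : ℝ) 1 := by rcases hs with rfl | rfl <;> simp
  have hbase : 128 / 127 * bellBase s ≤ bellBase t := by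
    rcases hs with rfl | rfl
    exacts [mul_bellBase_zero_le ht, bellBase_one ▸ mul_bellBase_zero_le ht]
  have hρ := bellBase_pos s
  refine abs_bellFunctional_le hs' (fun n => ?_) N'
  refine (norm_bellWeight_smul_le_of_endpoint (x := fun k => truncate N v k s) hC
    (fun k => ?_) m n).trans ?_
  · exact le_trans (by gcongr; exact norm_truncate_le N k v s) (hx k)
  · gcongr

theorem IsLadder.le_sub_bellFunctional_truncate {M η a : ℝ} {m N : ℕ} (hv : IsLadder A τ v v')
    (hM : ∀ t ∈ Set.Icc (0 : ℝ) 1, ‖v 0 t‖ ≤ M) (hη₀ : 0 ≤ η) (hη : η ≤ 1 / 2)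
    (ha : ∀ t, |t - 1 / 2| ≤ η → a ≤ ‖v 1 t‖ ^ 2) (hm : 1 ≤ m)
    (hmA : 3 * (A ^ 2 + τ ^ 2) ≤ m / 8)
    (hma : 3 * M ^ 2 ≤ (m / 8 - 3 * (A ^ 2 + τ ^ 2)) * a) (hN : 1 ≤ N)
    (htail : ∀ t ∈ Set.Icc (0 : ℝ) 1,
      3 * τ ^ 2 * (bellWeight m (N + 1) t ^ 2 * ‖v (N + 1) t‖ ^ 2)
        + bellWeight m (N + 1) t ^ 2 * ‖v N t‖ ^ 2 ≤ bellWeight m 1 (1 / 2 + η) ^ 2) :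
    bellWeight m 1 (1 / 2 + η) ^ 2 *
        (2 * η * ((m / 8 - 3 * (A ^ 2 + τ ^ 2)) * a) - (3 * M ^ 2 + 1))
      ≤ bellFunctional m (N + 1) (truncate N v) 1 - bellFunctional m (N + 1) (truncate N v) 0 := by
  set G := bellWeight m 1 (1 / 2 + η) ^ 2
  have hedge : |(1 / 2 + η) - 1 / 2| = η := by rw [add_sub_cancel_left, abs_of_nonneg hη₀]
  have hgrowth := two_mul_sub_le_sub_of_deriv_ge_near_half (p := 3 * M ^ 2 * G + G)
    (Q := G * ((m / 8 - 3 * (A ^ 2 + τ ^ 2)) * a - 3 * M ^ 2) - G) hη₀ hη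
    (continuousOn_bellFunctional (continuousOn_truncate hv.continuousOn N) m (N + 1)) fun t ht => by
      have ht' := Set.Ioo_subset_Icc_self ht
      obtain ⟨D, hD, hle⟩ :=
        hv.exists_deriv_truncate_ge_rung_one hm hmA hN ht (hM t ht') (htail t ht')
      refine ⟨D, hD, fun hnear => le_trans ?_ hle, fun hfar => le_trans ?_ hle⟩
      · have hw : G ≤ bellWeight m 1 t ^ 2 := pow_le_pow_left₀ (bellWeight_pos _ _ _).le
          (bellWeight_le_of_abs_le (hnear.trans hedge.ge) m 1) 2
        have := mul_le_mul_of_nonneg_left (ha t hnear) (sub_nonneg.2 hmA)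
        nlinarith
      · have hw : bellWeight m 1 t ^ 2 ≤ G := pow_le_pow_left₀ (bellWeight_pos _ _ _).le
          (bellWeight_le_of_abs_le (hedge.le.trans hfar) m 1) 2
        have := mul_nonneg (sub_nonneg.2 hmA) (sq_nonneg ‖v 1 t‖)
        nlinarith [sq_nonneg M, sq_nonneg (bellWeight m 1 t)]
  linarith

theorem IsLadder.le_sq_of_le_norm_rung_one {C M c r η a : ℝ} {m : ℕ} (hv : IsLadder A τ v v')
    (hM : ∀ t ∈ Set.Icc (0 : ℝ) 1, ‖v 0 t‖ ≤ M) (hr₀ : 0 ≤ r) (hr : r ≤ 11 / 8)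
    (hdecay : ∀ n : ℕ, ∀ t ∈ Set.Icc (0 : ℝ) 1, n.factorial * ‖v n t‖ ≤ c * r ^ n)
    (h0 : ∀ n : ℕ, n.factorial * 256 ^ n * ‖v n 0‖ ≤ C)
    (h1 : ∀ n : ℕ, n.factorial * 256 ^ n * ‖v n 1‖ ≤ C) (hη₀ : 0 ≤ η) (hη : η ≤ 1 / 4)
    (ha₀ : 0 ≤ a) (ha : ∀ t, |t - 1 / 2| ≤ η → a ≤ ‖v 1 t‖ ^ 2)
    (hm : 3 * M ^ 2 + 2 ≤ 2 * η * ((m / 8 - 3 * (A ^ 2 + τ ^ 2)) * a)) :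
    (m + 1) * bellBase (1 / 2 + η) ^ 2 ≤ C ^ 2 := by
  have hC : 0 ≤ C := (norm_nonneg (v 0 0)).trans (by simpa using h0 0)
  have hma : 3 * M ^ 2 ≤ (m / 8 - 3 * (A ^ 2 + τ ^ 2)) * a := by nlinarith [sq_nonneg M]
  have hmA : 3 * (A ^ 2 + τ ^ 2) < m / 8 := by nlinarith [sq_nonneg M]
  have hm₁ : 1 ≤ m := by
    have : (0 : ℝ) < m := by linarith [sq_nonneg A, sq_nonneg τ]
    exact_mod_cast this
  set G := bellWeight m 1 (1 / 2 + η) ^ 2 with hG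
  have hG₀ : 0 < G := pow_pos (bellWeight_pos _ _ _) 2
  obtain ⟨N, htail, hN⟩ := ((eventually_tail_le hr₀ hr hdecay m τ hG₀).and
    (Filter.eventually_ge_atTop 1)).exists
  have hgrowth := hv.le_sub_bellFunctional_truncate hM hη₀ (by linarith) ha hm₁ hmA.le hma hN htail
  have hη' : |(1 / 2 + η) - 1 / 2| ≤ 1 / 4 := by
    rwa [add_sub_cancel_left, abs_of_nonneg hη₀]
  have hF₀ := abs_bellFunctional_truncate_le hC h0 (.inl rfl) hη' m N (N + 1)
  have hF₁ := abs_bellFunctional_truncate_le hC h1 (.inr rfl) hη' m N (N + 1)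
  have hG_le : G ≤ (m + 1) * (C * (m.factorial * bellBase (1 / 2 + η) ^ m)) ^ 2 := by
    nlinarith [(abs_le.1 hF₀).1, (abs_le.1 hF₁).2]
  have hG_eq : G = (m + 1) * (m.factorial * bellBase (1 / 2 + η) ^ m) ^ 2 *
      ((m + 1) * bellBase (1 / 2 + η) ^ 2) := by
    rw [hG, bellWeight, add_comm 1 m, Nat.factorial_succ]
    push_cast
    ring
  have := bellBase_pos (1 / 2 + η)
  have hcancel : 0 < (m + 1) * (m.factorial * bellBase (1 / 2 + η) ^ m) ^ 2 := by positivity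
  rw [hG_eq] at hG_le
  refine le_of_mul_le_mul_left (hG_le.trans_eq ?_) hcancel
  ring

theorem exp_one_mul_half_add_le : Real.exp 1 * (1 / 2 + 1 / 256) ≤ 11 / 8 := by
  linarith [Real.exp_one_lt_d9]

theorem IsLadder.eq_zero_at_half {T C M : ℝ} (hv : IsLadder A τ v v') (hA : 0 ≤ A)
    (hτ : 0 ≤ τ) (hT : 0 < T) (hM : ∀ n, ∀ t ∈ Set.Icc (0 : ℝ) 1, T ^ n * ‖v n t‖ ≤ M)
    (h0 : ∀ n : ℕ, n.factorial * 256 ^ n * ‖v n 0‖ ≤ C)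
    (h1 : ∀ n : ℕ, n.factorial * 256 ^ n * ‖v n 1‖ ≤ C) : v 1 (1 / 2) = 0 := by
  by_contra hne
  obtain ⟨c, hdecay⟩ := hv.exists_factorial_decay hA hτ hT (by norm_num) hM h0 h1
  set a := ‖v 1 (1 / 2)‖ ^ 2 / 2 with ha_def
  have ha₀ : 0 < a := by have := norm_pos_iff.2 hne; positivity
  have hcont : ContinuousAt (fun t => ‖v 1 t‖ ^ 2) (1 / 2) :=
    (hv.hasDerivAt 1 _ (by norm_num)).continuousAt.norm.pow 2
  obtain ⟨δ, hδ, hball⟩ := Metric.eventually_nhds_iff.1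
    (hcont.eventually_const_lt (show a < ‖v 1 (1 / 2)‖ ^ 2 by linarith))
  set η := min (δ / 2) (1 / 4)
  have hη₀ : 0 < η := by positivity
  have hηδ : η ≤ δ / 2 := min_le_left _ _
  have hη : η ≤ 1 / 4 := min_le_right _ _
  have hlim : Filter.Tendsto
      (fun m : ℕ => 2 * η * (((m : ℝ) / 8 - 3 * (A ^ 2 + τ ^ 2)) * a)) Filter.atTop Filter.atTop :=
    ((Filter.tendsto_atTop_add_const_right _ _
      (tendsto_natCast_atTop_atTop.atTop_div_const (by norm_num))).atTop_mul_const
        ha₀).const_mul_atTop (by positivity)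
  obtain ⟨m, hm, hmC⟩ := ((hlim.eventually_ge_atTop (3 * M ^ 2 + 2)).and
    (tendsto_natCast_atTop_atTop.eventually_ge_atTop (C ^ 2 * (64 / 25)))).exists
  have hle := hv.le_sq_of_le_norm_rung_one (fun t ht => by simpa using hM 0 t ht) (by positivity)
    exp_one_mul_half_add_le hdecay h0 h1 hη₀.le hη ha₀.le
    (fun t ht => (hball (by rw [Real.dist_eq]; linarith)).le) hm
  have hρ := le_bellBase (t := 1 / 2 + η) ⟨by linarith, by linarith⟩
  have hρsq : 25 / 64 ≤ bellBase (1 / 2 + η) ^ 2 := by nlinarith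
  nlinarith

end LadderCarleman

section LatticeOperators

theorem lp_two_norm_sq {α : Type*} (f : lp (fun _ : α => ℝ) 2) : ‖f‖ ^ 2 = ∑' i, f i ^ 2 := by
  simpa using lp.norm_rpow_eq_tsum (p := 2) (by norm_num) f

theorem lp_two_summable_sq {α : Type*} (f : lp (fun _ : α => ℝ) 2) :
    Summable fun i => f i ^ 2 := by
  simpa using (lp.memℓp f).summable (by norm_num)

theorem lp_two_norm_le_mul {α : Type*} {f g : lp (fun _ : α => ℝ) 2} {A : ℝ} (hA : 0 ≤ A)
    (hgf : ∀ i, |g i| ≤ A * |f i|) : ‖g‖ ≤ A * ‖f‖ := by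
  refine le_of_sq_le_sq ?_ (by positivity)
  rw [mul_pow, lp_two_norm_sq, lp_two_norm_sq, ← tsum_mul_left]
  refine (lp_two_summable_sq g).tsum_le_tsum (fun i => ?_) ((lp_two_summable_sq f).mul_left _)
  rw [← sq_abs (g i), ← sq_abs (f i), ← mul_pow]
  exact pow_le_pow_left₀ (abs_nonneg _) (hgf i) 2

/-- Restriction of square summable functions along an injective map; it yields both the shifts of
the lattice and the restriction to a hyperplane. -/
noncomputable def lpRestrict {α β : Type*} (e : α → β) (he : Function.Injective e) :
    lp (fun _ : β => ℝ) 2 →L[ℝ] lp (fun _ : α => ℝ) 2 :=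
  LinearMap.mkContinuous
    { toFun := fun f => ⟨fun i => f (e i), memℓp_gen (by
        simpa [Function.comp_def] using (lp_two_summable_sq f).comp_injective he)⟩
      map_add' := fun f g => rfl
      map_smul' := fun c f => rfl } 1 (fun f => by
      refine le_of_sq_le_sq ?_ (by positivity)
      rw [one_mul, lp_two_norm_sq, lp_two_norm_sq]
      exact tsum_comp_le_tsum_of_inj (lp_two_summable_sq f) (fun i => sq_nonneg _) he)

theorem norm_lpRestrict_apply_le {α β : Type*} (e : α → β) (he : Function.Injective e)
    (f : lp (fun _ : β => ℝ) 2) : ‖lpRestrict e he f‖ ≤ ‖f‖ := by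
  simpa using (lpRestrict e he).le_of_opNorm_le (LinearMap.mkContinuous_norm_le _ zero_le_one _) f

/-- The discrete Laplacian as a bounded operator on square summable functions. -/
noncomputable def latticeLaplacian (d : ℕ) (h : ℝ) : LatticeL2 d →L[ℝ] LatticeL2 d :=
  (1 / h ^ 2) • ∑ k : Fin d,
    (lpRestrict (fun j : Fin d → ℤ => j + Pi.single k 1) (add_left_injective _)
      - (2 : ℝ) • ContinuousLinearMap.id ℝ _
      + lpRestrict (fun j : Fin d → ℤ => j - Pi.single k 1) sub_left_injective)

theorem latticeLaplacian_apply (d : ℕ) (h : ℝ) (f : LatticeL2 d) (j : Fin d → ℤ) :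
    latticeLaplacian d h f j = discreteLaplacian h f j := by
  simp only [latticeLaplacian, discreteLaplacian, smul_apply, sum_apply, lp.coeFn_smul,
    Pi.smul_apply, smul_eq_mul, lp.coeFn_sum, Finset.sum_apply]
  rfl

/-- The slice of a function on `ℤ^{n+1}` at first coordinate `i`. -/
noncomputable def latticeSlice (n : ℕ) (i : ℤ) : LatticeL2 (n + 1) →L[ℝ] LatticeL2 n :=
  lpRestrict (fun j : Fin n → ℤ => (Fin.cons i j : Fin (n + 1) → ℤ))
    (Fin.cons_right_injective (α := fun _ => ℤ) i)

theorem latticeSlice_apply (n : ℕ) (i : ℤ) (f : LatticeL2 (n + 1)) (j : Fin n → ℤ) :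
    latticeSlice n i f j = f (Fin.cons i j) := rfl

theorem norm_latticeSlice_le (n : ℕ) (i : ℤ) (f : LatticeL2 (n + 1)) :
    ‖latticeSlice n i f‖ ≤ ‖f‖ := norm_lpRestrict_apply_le _ _ f

theorem eq_zero_of_latticeSlice_eq_zero {n : ℕ} {f : LatticeL2 (n + 1)}
    (hf : ∀ i, latticeSlice n i f = 0) : f = 0 := by
  ext j
  have hj := congrArg (fun g : LatticeL2 n => g (Fin.tail j)) (hf (j 0))
  simpa [latticeSlice_apply, Fin.cons_self_tail] using hj

theorem cons_add_single_zero {α : Type*} [AddZeroClass α] {n : ℕ} (i a : α) (j : Fin n → α) :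
    (Fin.cons i j : Fin (n + 1) → α) + Pi.single 0 a = Fin.cons (i + a) j := by
  ext k
  refine Fin.cases ?_ (fun k => ?_) k <;> simp

theorem cons_add_single_succ {α : Type*} [AddZeroClass α] {n : ℕ} (i a : α) (j : Fin n → α)
    (k : Fin n) :
    (Fin.cons i j : Fin (n + 1) → α) + Pi.single k.succ a = Fin.cons i (j + Pi.single k a) := by
  ext l
  refine Fin.cases ?_ (fun l => ?_) l <;> simp [Pi.single_apply, Fin.succ_inj]

theorem latticeSlice_latticeLaplacian (n : ℕ) (h : ℝ) (i : ℤ) (f : LatticeL2 (n + 1)) :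
    latticeSlice n i (latticeLaplacian (n + 1) h f) =
      (1 / h ^ 2) • latticeSlice n (i - 1) f + (1 / h ^ 2) • latticeSlice n (i + 1) f
        + (latticeLaplacian n h (latticeSlice n i f) - (2 / h ^ 2) • latticeSlice n i f) := by
  ext j
  have hback : ∀ {m : ℕ} (l : Fin m → ℤ) (k : Fin m),
      l - Pi.single k 1 = l + Pi.single k (-1) := fun l k => by
    rw [Pi.single_neg, sub_eq_add_neg]
  rw [latticeSlice_apply, latticeLaplacian_apply]
  simp only [lp.coeFn_add, lp.coeFn_sub, lp.coeFn_smul, Pi.add_apply, Pi.sub_apply, Pi.smul_apply,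
    smul_eq_mul, latticeLaplacian_apply, discreteLaplacian, latticeSlice_apply, Fin.sum_univ_succ,
    hback, cons_add_single_zero, cons_add_single_succ, ← sub_eq_add_neg]
  ring

end LatticeOperators

section HeatEquation

variable {d : ℕ} {h : ℝ} {V : (Fin d → ℤ) → ℝ → ℝ} {u : ℝ → LatticeL2 d}

theorem IsHeatSolution.continuousOn (hu : IsHeatSolution h V u) :
    ContinuousOn u (Set.Icc 0 1) := hu.contDiffOn.continuousOn

theorem IsHeatSolution.hasDerivAt (hu : IsHeatSolution h V u) {t : ℝ}
    (ht : t ∈ Set.Ioo (0 : ℝ) 1) : HasDerivAt u (deriv u t) t :=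
  ((hu.contDiffOn.differentiableOn one_ne_zero t (Set.Ioo_subset_Icc_self ht)).differentiableAt
    (Icc_mem_nhds ht.1 ht.2)).hasDerivAt

theorem IsHeatSolution.deriv_sub_latticeLaplacian_apply (hu : IsHeatSolution h V u) {t : ℝ}
    (ht : t ∈ Set.Ioo (0 : ℝ) 1) (j : Fin d → ℤ) :
    (deriv u t - latticeLaplacian d h (u t)) j = V j t * u t j := by
  have hcoord : HasDerivAt (fun s => u s j) (deriv u t j) t :=
    (lp.evalCLM ℝ (fun _ : Fin d → ℤ => ℝ) 2 j).hasFDerivAt.comp_hasDerivAt t (hu.hasDerivAt ht)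
  rw [lp.coeFn_sub, Pi.sub_apply, hcoord.unique (hu.equation t ht j), latticeLaplacian_apply]
  ring

theorem abs_le_toReal_potentialNorm (hV : potentialNorm V < ⊤) (j : Fin d → ℤ) {t : ℝ}
    (ht : t ∈ Set.Icc (0 : ℝ) 1) : |V j t| ≤ (potentialNorm V).toReal := by
  refine (ENNReal.ofReal_le_iff_le_toReal hV.ne).1 ?_
  exact le_iSup_of_le (f := fun j => ⨆ t ∈ Set.Icc (0 : ℝ) 1, ENNReal.ofReal |V j t|) j
    (le_iSup₂_of_le (f := fun t (_ : t ∈ Set.Icc (0 : ℝ) 1) => ENNReal.ofReal |V j t|) t ht le_rfl)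

theorem IsHeatSolution.norm_deriv_le (hu : IsHeatSolution h V u) (hV : potentialNorm V < ⊤)
    {t : ℝ} (ht : t ∈ Set.Ioo (0 : ℝ) 1) :
    ‖deriv u t‖ ≤ ((potentialNorm V).toReal + ‖latticeLaplacian d h‖) * ‖u t‖ := by
  have hpotential : ‖deriv u t - latticeLaplacian d h (u t)‖ ≤ (potentialNorm V).toReal * ‖u t‖ :=
    lp_two_norm_le_mul ENNReal.toReal_nonneg fun j => by
      rw [hu.deriv_sub_latticeLaplacian_apply ht, abs_mul]
      gcongr
      exact abs_le_toReal_potentialNorm hV j (Set.Ioo_subset_Icc_self ht)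
  calc ‖deriv u t‖
      = ‖(deriv u t - latticeLaplacian d h (u t)) + latticeLaplacian d h (u t)‖ := by
        rw [sub_add_cancel]
    _ ≤ (potentialNorm V).toReal * ‖u t‖ + ‖latticeLaplacian d h‖ * ‖u t‖ :=
        norm_add_le_of_le hpotential ((latticeLaplacian d h).le_opNorm _)
    _ = _ := by rw [add_mul]

theorem IsHeatSolution.eq_zero_of_half (hu : IsHeatSolution h V u) (hV : potentialNorm V < ⊤)
    (hhalf : u (1 / 2) = 0) : ∀ t ∈ Set.Icc (0 : ℝ) 1, u t = 0 :=
  eq_zero_of_norm_deriv_le_mul_norm hu.continuousOn (fun _ ht => hu.hasDerivAt ht)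
    (fun _ ht => hu.norm_deriv_le hV ht) (by norm_num) hhalf

end HeatEquation

section Slices

variable {n : ℕ} {h : ℝ} {V : (Fin (n + 1) → ℤ) → ℝ → ℝ} {u : ℝ → LatticeL2 (n + 1)}

theorem IsHeatSolution.norm_latticeSlice_deriv_sub_le (hu : IsHeatSolution h V u)
    (hV : potentialNorm V < ⊤) (i : ℤ) {t : ℝ} (ht : t ∈ Set.Ioo (0 : ℝ) 1) :
    ‖latticeSlice n i (deriv u t) - (1 / h ^ 2) • latticeSlice n (i - 1) (u t)
        - (1 / h ^ 2) • latticeSlice n (i + 1) (u t)‖ ≤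
      ((potentialNorm V).toReal + ‖latticeLaplacian n h‖ + 2 / h ^ 2) *
        ‖latticeSlice n i (u t)‖ := by
  set v := latticeSlice n i (u t)
  set R := latticeSlice n i (deriv u t - latticeLaplacian (n + 1) h (u t)) with hR
  have hRle : ‖R‖ ≤ (potentialNorm V).toReal * ‖v‖ := by
    refine lp_two_norm_le_mul ENNReal.toReal_nonneg fun j => ?_
    rw [hR, latticeSlice_apply, latticeSlice_apply, hu.deriv_sub_latticeLaplacian_apply ht, abs_mul]
    gcongr
    exact abs_le_toReal_potentialNorm hV _ (Set.Ioo_subset_Icc_self ht)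
  have hdecomp : latticeSlice n i (deriv u t) - (1 / h ^ 2) • latticeSlice n (i - 1) (u t)
      - (1 / h ^ 2) • latticeSlice n (i + 1) (u t)
      = R + latticeLaplacian n h v - (2 / h ^ 2) • v := by
    rw [hR, map_sub, latticeSlice_latticeLaplacian]
    abel
  have hsmul : ‖(2 / h ^ 2) • v‖ = 2 / h ^ 2 * ‖v‖ := by
    rw [norm_smul, Real.norm_of_nonneg (by positivity)]
  rw [hdecomp, add_mul, add_mul]
  exact norm_sub_le_of_le (norm_add_le_of_le hRle ((latticeLaplacian n h).le_opNorm v)) hsmul.le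

/-- The factors `h ^ (2 k)` normalise the coupling to the previous slice. -/
theorem IsHeatSolution.isLadder (hu : IsHeatSolution h V u) (hh : 0 < h)
    (hV : potentialNorm V < ⊤) (s : ℤ) :
    IsLadder ((potentialNorm V).toReal + ‖latticeLaplacian n h‖ + 2 / h ^ 2) ((1 / h ^ 2) ^ 2)
      (fun k t => (h ^ 2) ^ k • latticeSlice n (s + k) (u t))
      (fun k t => (h ^ 2) ^ k • latticeSlice n (s + k) (deriv u t)) where
  continuousOn k := ((latticeSlice n (s + k)).continuous.comp_continuousOn
    hu.continuousOn).fun_const_smul _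
  hasDerivAt k t ht :=
    ((latticeSlice n (s + k)).hasFDerivAt.comp_hasDerivAt t (hu.hasDerivAt ht)).fun_const_smul _
  residual_le k t ht := by
    have hprev : s + (k : ℤ) = s + (k + 1 : ℕ) - 1 := by push_cast; ring
    have hnext : s + ((k + 2 : ℕ) : ℤ) = s + (k + 1 : ℕ) + 1 := by push_cast; ring
    have hcoeff_prev : (h ^ 2) ^ k = (h ^ 2) ^ (k + 1) * (1 / h ^ 2) := by
      rw [pow_succ (h ^ 2) k]; field_simp
    have hcoeff_next : (1 / h ^ 2) ^ 2 * (h ^ 2) ^ (k + 2) = (h ^ 2) ^ (k + 1) * (1 / h ^ 2) := by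
      rw [← hcoeff_prev, pow_add]; field_simp
    rw [hprev, hnext, smul_smul ((1 / h ^ 2) ^ 2), hcoeff_next, hcoeff_prev, mul_smul, mul_smul,
      ← smul_sub, ← smul_sub, norm_smul, norm_smul, mul_left_comm]
    gcongr
    exact hu.norm_latticeSlice_deriv_sub_le hV _ ht

theorem exists_factorial_decay_shift {a : ℤ → ℝ} {X C : ℝ} (hX : 0 < X) (ha : ∀ i, 0 ≤ a i)
    (hdec : ∀ k : ℕ, k.factorial * (2 * X) ^ k * a k ≤ C) (s : ℤ) :
    ∃ C', ∀ k : ℕ, k.factorial * X ^ k * a (s + k) ≤ C' := by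
  set r := s.natAbs
  have hevent : ∀ᶠ k : ℕ in Filter.atTop,
      k.factorial * X ^ k * a (s + k) ≤ 2 ^ r * r.factorial * X ^ (-s) * C := by
    filter_upwards [Filter.eventually_ge_atTop r] with k hk
    obtain ⟨i, hi⟩ : ∃ i : ℕ, s + k = i := Int.eq_ofNat_of_zero_le (by omega)
    have hfact : (k.factorial : ℝ) ≤ 2 ^ (i + r) * i.factorial * r.factorial := by
      have hki : k.factorial ≤ (i + r).factorial := Nat.factorial_le (by omega)
      rw [← Nat.add_choose_mul_factorial_mul_factorial i r] at hki
      exact_mod_cast hki.trans (by gcongr; exact Nat.choose_le_two_pow _ _)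
    have hpow : X ^ k = X ^ (-s) * X ^ i := by
      rw [← zpow_natCast, ← zpow_natCast, ← zpow_add₀ hX.ne', ← hi, neg_add_cancel_left]
    have hai := ha i
    calc k.factorial * X ^ k * a (s + k)
        ≤ 2 ^ (i + r) * i.factorial * r.factorial * X ^ k * a i := by rw [hi]; gcongr
      _ = 2 ^ r * r.factorial * X ^ (-s) * (i.factorial * (2 * X) ^ i * a i) := by
          rw [hpow, pow_add, mul_pow]; ring
      _ ≤ _ := by gcongr; exact hdec i
  obtain ⟨C', hC'⟩ := (Filter.isBoundedUnder_of_eventually_le hevent).bddAbove_range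
  exact ⟨C', fun k => hC' (Set.mem_range_self k)⟩

end Slices

section WeightedEnergy

variable {n : ℕ} {h c : ℝ} {V : (Fin (n + 1) → ℤ) → ℝ → ℝ} {u : ℝ → LatticeL2 (n + 1)}
  {W : (Fin (n + 1) → ℤ) → ℝ}

theorem mul_norm_latticeSlice_sq_le {w t : ℝ} {i : ℤ} (hh : 0 < h) (hw : 0 ≤ w)
    (hwW : ∀ j : Fin n → ℤ, w ≤ W (Fin.cons i j)) (hE : twoTimeEnergy h W u < ⊤)
    (ht : t = 0 ∨ t = 1) :
    w * ‖latticeSlice n i (u t)‖ ^ 2 ≤ (twoTimeEnergy h W u).toReal / h ^ (n + 1) := by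
  rw [le_div_iff₀' (by positivity), ← ENNReal.ofReal_le_iff_le_toReal hE.ne, twoTimeEnergy,
    ENNReal.ofReal_mul (by positivity), lp_two_norm_sq, ← tsum_mul_left,
    ENNReal.ofReal_tsum_of_nonneg (fun j => mul_nonneg hw (sq_nonneg _))
      ((lp_two_summable_sq _).mul_left _)]
  gcongr
  have hsq : ∀ j, u t j ^ 2 ≤ |u 0 j| ^ 2 + |u 1 j| ^ 2 := fun j => by
    rcases ht with rfl | rfl <;> simp only [sq_abs] <;> nlinarith [sq_nonneg (u 0 j),
      sq_nonneg (u 1 j)]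
  calc ∑' j : Fin n → ℤ, ENNReal.ofReal (w * latticeSlice n i (u t) j ^ 2)
      ≤ ∑' j : Fin n → ℤ, ENNReal.ofReal (W (Fin.cons i j) *
          (|u 0 (Fin.cons i j)| ^ 2 + |u 1 (Fin.cons i j)| ^ 2)) := by
        refine ENNReal.tsum_le_tsum fun j => ENNReal.ofReal_le_ofReal ?_
        exact mul_le_mul (hwW j) (hsq _) (sq_nonneg _) (hw.trans (hwW j))
    _ ≤ _ := ENNReal.tsum_comp_le_tsum_of_injective
        (Fin.cons_right_injective (α := fun _ => ℤ) i) _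

theorem mul_norm_latticeSlice_le_sqrt {b t : ℝ} {i : ℤ} (hh : 0 < h) (hc : 0 < c)
    (hbW : ∀ j : Fin n → ℤ, b ^ 2 ≤ c * W (Fin.cons i j)) (hE : twoTimeEnergy h W u < ⊤)
    (ht : t = 0 ∨ t = 1) :
    b * ‖latticeSlice n i (u t)‖ ≤ √(c * ((twoTimeEnergy h W u).toReal / h ^ (n + 1))) := by
  refine Real.le_sqrt_of_sq_le ?_
  have hslice := mul_norm_latticeSlice_sq_le (w := b ^ 2 / c) (i := i) hh (by positivity)
    (fun j => (div_le_iff₀' hc).2 (hbW j)) hE ht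
  rwa [div_mul_eq_mul_div, div_le_iff₀' hc, ← mul_pow] at hslice

theorem IsHeatSolution.latticeSlice_half_eq_zero (hu : IsHeatSolution h V u) (hh : 0 < h)
    (hV : potentialNorm V < ⊤) {C₀ C₁ : ℝ}
    (h₀ : ∀ k : ℕ, k.factorial * (2 * (256 * h ^ 2)) ^ k * ‖latticeSlice n k (u 0)‖ ≤ C₀)
    (h₁ : ∀ k : ℕ, k.factorial * (2 * (256 * h ^ 2)) ^ k * ‖latticeSlice n k (u 1)‖ ≤ C₁)
    (i : ℤ) : latticeSlice n i (u (1 / 2)) = 0 := by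
  obtain ⟨M, hM⟩ := isCompact_Icc.exists_bound_of_continuousOn hu.continuousOn
  have hX : 0 < 256 * h ^ 2 := by positivity
  obtain ⟨C₀', hC₀'⟩ := exists_factorial_decay_shift
    (a := fun k => ‖latticeSlice n k (u 0)‖) hX (fun _ => norm_nonneg _) h₀ (i - 1)
  obtain ⟨C₁', hC₁'⟩ := exists_factorial_decay_shift
    (a := fun k => ‖latticeSlice n k (u 1)‖) hX (fun _ => norm_nonneg _) h₁ (i - 1)
  have hnorm : ∀ (k : ℕ) (t : ℝ), ‖(h ^ 2) ^ k • latticeSlice n (i - 1 + k) (u t)‖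
      = (h ^ 2) ^ k * ‖latticeSlice n (i - 1 + k) (u t)‖ := fun k t => by
    rw [norm_smul, Real.norm_of_nonneg (by positivity)]
  have hscale : ∀ (k : ℕ) (t : ℝ),
      k.factorial * 256 ^ k * ‖(h ^ 2) ^ k • latticeSlice n (i - 1 + k) (u t)‖
        = k.factorial * (256 * h ^ 2) ^ k * ‖latticeSlice n (i - 1 + k) (u t)‖ := fun k t => by
    rw [hnorm, mul_pow]; ring
  have hbounded : ∀ (k : ℕ), ∀ t ∈ Set.Icc (0 : ℝ) 1,
      (1 / h ^ 2) ^ k * ‖(h ^ 2) ^ k • latticeSlice n (i - 1 + k) (u t)‖ ≤ M := fun k t ht => by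
    rw [hnorm, ← mul_assoc, ← mul_pow, one_div_mul_cancel (by positivity), one_pow, one_mul]
    exact (norm_latticeSlice_le _ _ _).trans (hM t ht)
  have hrung := (hu.isLadder hh hV (i - 1)).eq_zero_at_half (C := max C₀' C₁')
    (by positivity) (by positivity) (by positivity) hbounded
    (fun k => (hscale k 0).trans_le ((hC₀' k).trans (le_max_left _ _)))
    (fun k => (hscale k 1).trans_le ((hC₁' k).trans (le_max_right _ _)))
  simpa [hh.ne'] using hrung

theorem IsHeatSolution.eq_zero_of_twoTimeEnergy_lt_top (hu : IsHeatSolution h V u) (hh : 0 < h)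
    (hV : potentialNorm V < ⊤) (hc : 0 < c)
    (hW : ∀ (k : ℕ) (j : Fin n → ℤ),
      (k.factorial * (512 * h ^ 2) ^ k) ^ 2 ≤ c * W (Fin.cons (k : ℤ) j))
    (hE : twoTimeEnergy h W u < ⊤) : ∀ t ∈ Set.Icc (0 : ℝ) 1, u t = 0 := by
  rw [show 512 * h ^ 2 = 2 * (256 * h ^ 2) by ring] at hW
  refine hu.eq_zero_of_half hV (eq_zero_of_latticeSlice_eq_zero ?_)
  exact hu.latticeSlice_half_eq_zero hh hV
    (fun k => mul_norm_latticeSlice_le_sqrt hh hc (hW k) hE (.inl rfl))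
    (fun k => mul_norm_latticeSlice_le_sqrt hh hc (hW k) hE (.inr rfl))

end WeightedEnergy

section Macdonald

variable {ν ν' z : ℝ}

theorem cosh_mul_le_exp {s : ℝ} (hs : 0 ≤ s) : Real.cosh (ν * s) ≤ Real.exp (|ν| * s) := by
  rw [← Real.cosh_abs, abs_mul, abs_of_nonneg hs, Real.cosh_eq]
  have hneg : Real.exp (-(|ν| * s)) ≤ Real.exp (|ν| * s) :=
    Real.exp_le_exp.2 (neg_le_self (by positivity))
  linarith

theorem sq_div_four_le_cosh {s : ℝ} (hs : 0 ≤ s) : s ^ 2 / 4 ≤ Real.cosh s := by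
  rw [Real.cosh_eq]
  linarith [Real.quadratic_le_exp_of_nonneg hs, Real.exp_pos (-s)]

theorem macdonaldK_integrableOn (ν : ℝ) (hz : 0 < z) :
    MeasureTheory.IntegrableOn (fun s : ℝ => Real.exp (-z * Real.cosh s) * Real.cosh (ν * s))
      (Set.Ioi 0) := by
  refine integrable_of_isBigO_exp_neg (b := 1) one_pos (by fun_prop)
    (Asymptotics.IsBigO.of_bound (Real.exp ((|ν| + 1) ^ 2 / z)) ?_)
  filter_upwards [Filter.eventually_ge_atTop (0 : ℝ)] with s hs
  rw [Real.norm_of_nonneg (by positivity), Real.norm_of_nonneg (by positivity)]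
  have hcosh : z * (s ^ 2 / 4) ≤ z * Real.cosh s := by
    gcongr; exact sq_div_four_le_cosh hs
  have hsquare : (|ν| + 1) ^ 2 / z + z * (s ^ 2 / 4) - (|ν| + 1) * s
      = (|ν| + 1 - z * s / 2) ^ 2 / z := by field_simp; ring
  have hnonneg : 0 ≤ (|ν| + 1 - z * s / 2) ^ 2 / z := by positivity
  calc Real.exp (-z * Real.cosh s) * Real.cosh (ν * s)
      ≤ Real.exp (-z * Real.cosh s) * Real.exp (|ν| * s) := by gcongr; exact cosh_mul_le_exp hs
    _ ≤ Real.exp ((|ν| + 1) ^ 2 / z) * Real.exp (-1 * s) := by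
        rw [← Real.exp_add, ← Real.exp_add, Real.exp_le_exp]
        linarith

theorem macdonaldK_le_of_abs_le (hz : 0 < z) (hνν' : |ν| ≤ |ν'|) :
    macdonaldK ν z ≤ macdonaldK ν' z := by
  refine MeasureTheory.setIntegral_mono_on (macdonaldK_integrableOn ν hz)
    (macdonaldK_integrableOn ν' hz) measurableSet_Ioi fun s _ => ?_
  gcongr
  rw [Real.cosh_le_cosh, abs_mul, abs_mul]
  gcongr

theorem rpow_mul_exp_le_macdonaldK {x : ℝ} (hν : 0 ≤ ν) (hz : 0 < z) (hx : 1 ≤ x) :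
    1 / 2 * x ^ ν * Real.exp (-(3 * z * x)) ≤ macdonaldK ν z := by
  have hx₀ : 0 < x := one_pos.trans_le hx
  set I := Set.Ioc (Real.log x) (Real.log x + 1)
  have hI : I ⊆ Set.Ioi 0 := fun s hs => (Real.log_nonneg hx).trans_lt hs.1
  calc 1 / 2 * x ^ ν * Real.exp (-(3 * z * x))
      = ∫ _ in I, 1 / 2 * x ^ ν * Real.exp (-(3 * z * x)) := by simp [I]
    _ ≤ ∫ s in I, Real.exp (-z * Real.cosh s) * Real.cosh (ν * s) := by
        refine MeasureTheory.setIntegral_mono_on continuous_const.integrableOn_Ioc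
          ((macdonaldK_integrableOn ν hz).mono_set hI) measurableSet_Ioc fun s hs => ?_
        have hcosh : Real.cosh s ≤ 3 * x := by
          calc Real.cosh s ≤ Real.exp s := by
                simpa using cosh_mul_le_exp (ν := 1) (hI hs).le
            _ ≤ Real.exp (Real.log x + 1) := Real.exp_le_exp.2 hs.2
            _ = x * Real.exp 1 := by rw [Real.exp_add, Real.exp_log hx₀]
            _ ≤ 3 * x := by rw [mul_comm]; gcongr; exact Real.exp_one_lt_three.le
        have hgrowth : 1 / 2 * x ^ ν ≤ Real.cosh (ν * s) := by
          have hexp : x ^ ν ≤ Real.exp (ν * s) := by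
            rw [Real.rpow_def_of_pos hx₀, mul_comm]
            gcongr
            exact hs.1.le
          rw [Real.cosh_eq]
          linarith [Real.exp_pos (-(ν * s))]
        have hdecay : Real.exp (-(3 * z * x)) ≤ Real.exp (-z * Real.cosh s) := by
          rw [Real.exp_le_exp]
          nlinarith
        rw [mul_comm]
        gcongr
    _ ≤ macdonaldK ν z := MeasureTheory.setIntegral_mono_set (macdonaldK_integrableOn ν hz)
        (Filter.Eventually.of_forall fun s => by positivity) hI.eventuallyLE

theorem macdonaldK_pos (ν : ℝ) (hz : 0 < z) : 0 < macdonaldK ν z :=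
  lt_of_lt_of_le (by positivity)
    ((rpow_mul_exp_le_macdonaldK le_rfl hz le_rfl).trans (macdonaldK_le_of_abs_le hz (by simp)))

theorem one_le_macdonaldK_div_macdonaldK_zero (ν : ℝ) (hz : 0 < z) :
    1 ≤ macdonaldK ν z / macdonaldK 0 z := by
  rw [one_le_div (macdonaldK_pos 0 hz)]
  exact macdonaldK_le_of_abs_le hz (by simp)

theorem factorial_div_pow_le_macdonaldK (k : ℕ) (hz : 0 < z) :
    k.factorial / (9 * z) ^ k ≤ 2 * Real.exp (3 * z) * macdonaldK k z := by
  set x := 1 + k / (3 * z) with hx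
  have hx₁ : 1 ≤ x := le_add_of_nonneg_right (by positivity)
  have hfactorial : (k.factorial : ℝ) ≤ (k : ℝ) ^ k := by exact_mod_cast Nat.factorial_le_pow k
  have hexp : Real.exp (3 * z * x) ≤ Real.exp (3 * z) * 3 ^ k := by
    rw [hx, mul_add, mul_one, mul_div_cancel₀ _ (by positivity), Real.exp_add, ← Real.exp_one_pow]
    gcongr
    exact Real.exp_one_lt_three.le
  have hlower := rpow_mul_exp_le_macdonaldK k.cast_nonneg hz hx₁
  rw [Real.rpow_natCast, Real.exp_neg, ← div_eq_mul_inv, div_le_iff₀ (Real.exp_pos _)] at hlower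
  have hK := (macdonaldK_pos k hz).le
  calc k.factorial / (9 * z) ^ k ≤ (k : ℝ) ^ k / (9 * z) ^ k := by gcongr
    _ = (k / (3 * z)) ^ k / 3 ^ k := by
        rw [div_pow, div_div, ← mul_pow]; ring_nf
    _ ≤ x ^ k / 3 ^ k := by gcongr; linarith
    _ ≤ 2 * (macdonaldK k z * (Real.exp (3 * z) * 3 ^ k)) / 3 ^ k := by
        gcongr
        linarith [mul_le_mul_of_nonneg_left hexp hK]
    _ = 2 * Real.exp (3 * z) * macdonaldK k z := by field_simp

theorem exists_pow_le_mul_rpow_pow (a : ℝ) {δ : ℝ} (hδ : 0 < δ) (ha : 0 ≤ a) :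
    ∃ C, 0 < C ∧ ∀ k : ℕ, a ^ k ≤ C * (((k : ℝ) + 1) ^ δ) ^ k := by
  have hlim : Filter.Tendsto (fun k : ℕ => ((k : ℝ) + 1) ^ δ) Filter.atTop Filter.atTop :=
    (tendsto_rpow_atTop hδ).comp
      (Filter.tendsto_atTop_add_const_right _ _ tendsto_natCast_atTop_atTop)
  obtain ⟨N, hN⟩ := Filter.eventually_atTop.1 (hlim.eventually_ge_atTop a)
  have hC : 1 ≤ max 1 a ^ N := one_le_pow₀ (le_max_left _ _)
  refine ⟨max 1 a ^ N, by positivity, fun k => ?_⟩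
  rcases le_total N k with hk | hk
  · calc a ^ k ≤ (((k : ℝ) + 1) ^ δ) ^ k := by gcongr; exact hN k hk
      _ ≤ _ := le_mul_of_one_le_left (by positivity) hC
  · have hbase : 1 ≤ (((k : ℝ) + 1) ^ δ) ^ k :=
      one_le_pow₀ (Real.one_le_rpow (by linarith [k.cast_nonneg (α := ℝ)]) hδ.le)
    calc a ^ k ≤ max 1 a ^ k := by gcongr; exact le_max_right _ _
      _ ≤ max 1 a ^ N := pow_le_pow_right₀ (le_max_left _ _) hk
      _ ≤ _ := le_mul_of_one_le_right (by positivity) hbase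

theorem exists_sq_factorial_mul_pow_le_macdonaldK {R μ : ℝ} (hμ : 2 < μ) (hz : 0 < z) :
    ∃ c, 0 < c ∧ ∀ k : ℕ, (k.factorial * R ^ k) ^ 2 ≤ c * macdonaldK (k * μ) z := by
  obtain ⟨C, hC, hpow⟩ := exists_pow_le_mul_rpow_pow (R ^ 2 * Real.exp (3 * z))
    (sub_pos.2 hμ) (by positivity)
  refine ⟨2 * C * Real.exp (3 * z), by positivity, fun k => ?_⟩
  set y := (k : ℝ) + 1 with hy
  have hy₀ : 0 < y := by positivity
  have hfactorial : (k.factorial : ℝ) ≤ y ^ k := by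
    calc (k.factorial : ℝ) ≤ (k : ℝ) ^ k := by exact_mod_cast Nat.factorial_le_pow k
      _ ≤ y ^ k := by gcongr; linarith
  have hrpow : y ^ (k * μ) = (y ^ k) ^ 2 * (y ^ (μ - 2)) ^ k := by
    rw [mul_comm (k : ℝ), Real.rpow_mul_natCast hy₀.le, Real.rpow_sub hy₀, Real.rpow_ofNat, div_pow,
      ← pow_mul, ← pow_mul, mul_comm 2 k, mul_div_cancel₀ _ (by positivity)]
  have hexp : Real.exp (3 * z * y) = Real.exp (3 * z) ^ k * Real.exp (3 * z) := by
    rw [hy, mul_add, mul_one, Real.exp_add, mul_comm, ← Real.exp_nat_mul, mul_comm _ (3 * z),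
      mul_comm]
  have hlower := rpow_mul_exp_le_macdonaldK (ν := k * μ) (by positivity) hz
    (show 1 ≤ y by rw [hy]; linarith [k.cast_nonneg (α := ℝ)])
  calc (k.factorial * R ^ k) ^ 2
      = (k.factorial : ℝ) ^ 2 * (R ^ 2 * Real.exp (3 * z)) ^ k / Real.exp (3 * z) ^ k := by
        rw [mul_pow, mul_pow (R ^ 2), pow_right_comm R 2]; field_simp
    _ ≤ (y ^ k) ^ 2 * (C * (y ^ (μ - 2)) ^ k) / Real.exp (3 * z) ^ k := by
        gcongr
        exact hpow k
    _ = 2 * C * Real.exp (3 * z) * (1 / 2 * y ^ (k * μ) * Real.exp (-(3 * z * y))) := by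
        rw [hrpow, Real.exp_neg, hexp]; field_simp
    _ ≤ _ := by gcongr

end Macdonald

section Weights

theorem le_prod_cons {α : Type*} {n : ℕ} {w : α → ℝ} (hw : ∀ i, 1 ≤ w i) (i : α) (j : Fin n → α) :
    w i ≤ ∏ k, w ((Fin.cons i j : Fin (n + 1) → α) k) := by
  rw [Fin.prod_univ_succ, Fin.cons_zero]
  exact le_mul_of_one_le_right (zero_le_one.trans (hw i)) (Finset.one_le_prod fun _ _ => hw _)

variable {n : ℕ} {h : ℝ}

theorem exists_sq_factorial_le_continuumWeight {γ : ℝ} (hh : 0 < h) (hγ : 0 < γ)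
    (hγC : γ ≤ 1 / 4608) :
    ∃ c, 0 < c ∧ ∀ (k : ℕ) (j : Fin n → ℤ),
      (k.factorial * (512 * h ^ 2) ^ k) ^ 2 ≤ c * continuumWeight γ h (Fin.cons (k : ℤ) j) := by
  have hz : 0 < γ / h ^ 2 := by positivity
  have hK₀ := macdonaldK_pos 0 hz
  set z := γ / h ^ 2 with hz_def
  refine ⟨(2 * Real.exp (3 * z) * macdonaldK 0 z) ^ 2, by positivity, fun k j => ?_⟩
  have hscale : 512 * h ^ 2 ≤ (9 * z)⁻¹ := by
    rw [le_inv_comm₀ (by positivity) (by positivity), hz_def, ← one_div,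
      le_div_iff₀ (by positivity)]
    field_simp
    linarith
  have hK : k.factorial * (512 * h ^ 2) ^ k ≤ 2 * Real.exp (3 * z) * macdonaldK k z := by
    refine le_trans ?_ (factorial_div_pow_le_macdonaldK k hz)
    rw [div_eq_mul_inv, ← inv_pow]
    gcongr
  calc (k.factorial * (512 * h ^ 2) ^ k) ^ 2
      ≤ (2 * Real.exp (3 * z) * macdonaldK k z) ^ 2 := by gcongr
    _ = (2 * Real.exp (3 * z) * macdonaldK 0 z) ^ 2 *
          (macdonaldK ((k : ℤ) : ℝ) z ^ 2 / macdonaldK 0 z ^ 2) := by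
        rw [Int.cast_natCast]; field_simp
    _ ≤ _ := by
        gcongr
        exact le_prod_cons (w := fun i : ℤ => macdonaldK i z ^ 2 / macdonaldK 0 z ^ 2)
          (fun i => by
            rw [← div_pow]; exact one_le_pow₀ (one_le_macdonaldK_div_macdonaldK_zero _ hz)) k j

theorem exists_sq_factorial_le_discreteWeight {μ : ℝ} (R : ℝ) (hh : 0 < h) (hμ : 2 < μ) :
    ∃ c, 0 < c ∧ ∀ (k : ℕ) (j : Fin n → ℤ),
      (k.factorial * R ^ k) ^ 2 ≤ c * discreteWeight μ h (Fin.cons (k : ℤ) j) := by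
  have hz : 0 < 2 / (Real.exp 1 * h ^ 2) := by positivity
  set z := 2 / (Real.exp 1 * h ^ 2)
  have hK₀ := macdonaldK_pos 0 hz
  obtain ⟨c, hc, hbound⟩ := exists_sq_factorial_mul_pow_le_macdonaldK (R := R) hμ hz
  refine ⟨c * macdonaldK 0 z, by positivity, fun k j => ?_⟩
  calc (k.factorial * R ^ k) ^ 2 ≤ c * macdonaldK (k * μ) z := hbound k
    _ = c * macdonaldK 0 z * (macdonaldK (((k : ℤ) : ℝ) * μ) z / macdonaldK 0 z) := by
        rw [Int.cast_natCast]; field_simp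
    _ ≤ _ := by
        gcongr
        exact le_prod_cons (w := fun i : ℤ => macdonaldK (i * μ) z / macdonaldK 0 z)
          (fun i => one_le_macdonaldK_div_macdonaldK_zero _ hz) k j

end Weights

theorem theorem1p1_general {d : ℕ} (hd : 1 ≤ d) {h : ℝ} (hh : 0 < h)
    {V : (Fin d → ℤ) → ℝ → ℝ} {u : ℝ → LatticeL2 d} (hu : IsHeatSolution h V u)
    (hV : potentialNorm V < ⊤) :
    (∀ γ : ℝ, 0 < γ → γ ≤ 1 / 4608 → twoTimeEnergy h (continuumWeight γ h) u < ⊤ →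
      ∀ t ∈ Set.Icc (0 : ℝ) 1, u t = 0) ∧
    (∀ μ : ℝ, 2 < μ → twoTimeEnergy h (discreteWeight μ h) u < ⊤ →
      ∀ t ∈ Set.Icc (0 : ℝ) 1, u t = 0) := by
  obtain ⟨n, rfl⟩ := Nat.exists_eq_add_of_le' hd
  refine ⟨fun γ hγ hγC hE => ?_, fun μ hμ hE => ?_⟩
  · obtain ⟨c, hc, hW⟩ := exists_sq_factorial_le_continuumWeight (n := n) hh hγ hγC
    exact hu.eq_zero_of_twoTimeEnergy_lt_top hh hV hc hW hE
  · obtain ⟨c, hc, hW⟩ := exists_sq_factorial_le_discreteWeight (n := n) (512 * h ^ 2) hh hμ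
    exact hu.eq_zero_of_twoTimeEnergy_lt_top hh hV hc hW hE

theorem theorem1p1 (d : ℕ) (hd : 1 ≤ d) :
    (∃ C : ℝ, 0 < C ∧ ∀ γ : ℝ, 0 < γ → γ < C → ∀ A B c : ℝ≥0, ∃ h₀ : ℝ, 0 < h₀ ∧
      ∀ h : ℝ, 0 < h → h < h₀ → ∀ (V : (Fin d → ℤ) → ℝ → ℝ) (u : ℝ → LatticeL2 d),
        IsHeatSolution h V u → potentialNorm V ≤ A → spaceTimeNorm h u ≤ B →
        twoTimeEnergy h (continuumWeight γ h) u ≤ c →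
        ∀ t ∈ Set.Icc (0 : ℝ) 1, u t = 0) ∧
    (∃ μ₀ : ℝ, 0 < μ₀ ∧ ∀ μ : ℝ, μ₀ < μ → ∀ h : ℝ, 0 < h →
      ∀ (V : (Fin d → ℤ) → ℝ → ℝ) (u : ℝ → LatticeL2 d),
        IsHeatSolution h V u → potentialNorm V < ⊤ → spaceTimeNorm h u < ⊤ →
        twoTimeEnergy h (discreteWeight μ h) u < ⊤ →
        ∀ t ∈ Set.Icc (0 : ℝ) 1, u t = 0) :=
  ⟨⟨1 / 4608, by norm_num, fun γ hγ hγC _ _ _ => ⟨1, one_pos, fun _ hh _ _ _ hu hV _ hE =>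
      (theorem1p1_general hd hh hu (hV.trans_lt ENNReal.coe_lt_top)).1 γ hγ hγC.le
        (hE.trans_lt ENNReal.coe_lt_top)⟩⟩,
    2, two_pos, fun μ hμ _ hh _ _ hu hV _ hE => (theorem1p1_general hd hh hu hV).2 μ hμ hE⟩
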